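/- **Theorem.** Let $a,b,r\ge 1$ be integers and let $V=\mathbb{C}^r$ with coordinate functions $x_1,\dots,x_r$. Let $G=G(ab,b,r)\subset \mathrm{GL}(V)$ be the group of monomial $r\times r$ matrices whose nonzero entries are $(ab)$-th roots of unity and in which the product of the nonzero entries is an $a$-th root of unity. Let $1\le s<ab$ with $\gcd(s,ab)=1$, let $\zeta_{ab}$ be a primitive $(ab)$-th root of unity, let $\sigma\in\mathrm{Gal}(\mathbb{Q}(\zeta_{ab})/\mathbb{Q})$ be given by $\sigma(\zeta_{ab})=\zeta_{ab}^s$, and let $V^\sigma$ be the representation of $G$ on $\mathbb{C}^r$ obtained by applying $\sigma$ to the matrix entries, with coordinate functions $x_1^\sigma,\dots,x_r^\sigma\in (V^\sigma)^*$. Let $S(V^*)=\mathbb{C}[x_1,\dots,x_r]$, let $I_G^+\subset S(V^*)$ be the ideal generated by the homogeneous $G$-invariant polynomials of positive degree, and let $\mathcal{C}_G\subset S(V^*)$ be the space of $G$-harmonic polynomials, i.e. those annihilated by all $G$-invariant constant-coefficient polynomial differential operators without constant term. Then $S(V^*)=\mathcal{C}_G\oplus I_G^+$; let $\eta_G:S(V^*)\to\mathcal{C}_G$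 be the corresponding projection. Let $(U^G_\sigma)^*:=(\mathcal{C}_G\otimes (V^\sigma)^*)^G$ be the dual Orlik–Solomon space, graded by polynomial degree, and let $(\tilde U^G_\sigma)^*:=\mathrm{span}_{\mathbb{C}}\{\tilde u_1^G,\dots,\tilde u_r^G\}\subset S(V^*)\otimes (V^\sigma)^*$, where \[\tilde u_i^G=\sum_{j=1}^r x_j^{abi-s}\otimes x_j^\sigma\quad(1\le i<r),\qquad \tilde u_r^G=\sum_{j=1}^r (x_1\cdots x_r)^{\lceil s/a\rceil a}\,x_j^{-s}\otimes x_j^\sigma .\] Then $\eta_G\otimes 1$ restricts to an isomorphism of graded vector spaces $(\tilde U^G_\sigma)^*\to (U^G_\sigma)^*$. Moreover, the multiset of $V^\sigma$-exponents of $G$ (the multiset in which each integer $e\ge 0$ occurs with multiplicity equal to the dimension of the degree-$e$ part of $(\mathcal{C}_G\otimes (V^\sigma)^*)^G$) is \[\Bigl\{\,ab-s,\ 2ab-s,\ \dots,\ (r-1)ab-s,\ \Bigl\lceil \frac{s}{a}\Bigr\rceil ar-s\,\Bigr\}.\] -/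

import Mathlib

open scoped TensorProduct

namespace ReflExp

noncomputable section

/-- The `ℂ`-algebra endomorphism of `ℂ[X_1, …, X_r]` given by the linear substitution
`X_j ↦ ∑ i, A i j * X_i` (so `A` acts on the span of the variables through its columns). -/
def linSubst {r : ℕ} (A : Matrix (Fin r) (Fin r) ℂ) :
    MvPolynomial (Fin r) ℂ →ₐ[ℂ] MvPolynomial (Fin r) ℂ :=
  MvPolynomial.aeval fun j => ∑ i, MvPolynomial.C (A i j) * MvPolynomial.X i

theorem linSubst_one {r : ℕ} :
    linSubst (1 : Matrix (Fin r) (Fin r) ℂ) = AlgHom.id ℂ _ := by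
  ext1 j
  simp [linSubst, Matrix.one_apply]

theorem linSubst_mul {r : ℕ} (A B : Matrix (Fin r) (Fin r) ℂ) :
    linSubst (A * B) = (linSubst A).comp (linSubst B) := by
  ext1 j
  simp only [linSubst, AlgHom.comp_apply, MvPolynomial.aeval_X, map_sum, map_mul,
    MvPolynomial.algHom_C, MvPolynomial.algebraMap_eq, Matrix.mul_apply, Finset.mul_sum,
    Finset.sum_mul]
  rw [Finset.sum_comm]
  refine Finset.sum_congr rfl fun k _ => Finset.sum_congr rfl fun i _ => ?_
  ring

section General

variable {r : ℕ} {Γ : Type*} [Group Γ]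

/-- The representation on `V = ℂ^r` given by matrices `φ g` acting on column vectors. -/
def natRep (φ : Γ →* GL (Fin r) ℂ) : Representation ℂ Γ (Fin r → ℂ) :=
  (Matrix.toLinAlgEquiv' :
      Matrix (Fin r) (Fin r) ℂ ≃ₐ[ℂ] Module.End ℂ (Fin r → ℂ)).toAlgHom.toMonoidHom.comp
    ((Units.coeHom _).comp φ)

/-- The contragredient action on `S(V^*) = ℂ[x_1, …, x_r]`, the polynomial functions on `V = ℂ^r`
with coordinates `x_j`: `(g f)(v) = f (g⁻¹ v)`. -/
def polyRep (φ : Γ →* GL (Fin r) ℂ) : Representation ℂ Γ (MvPolynomial (Fin r) ℂ) where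
  toFun g := (linSubst ((φ g⁻¹ : GL (Fin r) ℂ) : Matrix (Fin r) (Fin r) ℂ).transpose).toLinearMap
  map_one' := by
    rw [inv_one, map_one, Units.val_one, Matrix.transpose_one, linSubst_one]
    rfl
  map_mul' g h := by
    rw [mul_inv_rev, map_mul, Units.val_mul, Matrix.transpose_mul, linSubst_mul]
    rfl

/-- The ideal `I_G^+` of `S(V^*)` generated by the homogeneous `G`-invariant polynomials of
positive degree. -/
def invIdeal (φ : Γ →* GL (Fin r) ℂ) : Ideal (MvPolynomial (Fin r) ℂ) :=
  Ideal.span {f | f ∈ (polyRep φ).invariants ∧ ∃ d : ℕ, 0 < d ∧ f.IsHomogeneous d}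

/-- The constant-coefficient differential operator `∏ i, (∂/∂x_i)^(m i)`. -/
def monomialDiff (m : Fin r →₀ ℕ) : Module.End ℂ (MvPolynomial (Fin r) ℂ) :=
  ((List.finRange r).map fun i =>
    ((MvPolynomial.pderiv i).toLinearMap : Module.End ℂ (MvPolynomial (Fin r) ℂ)) ^ m i).prod

/-- The polynomial differential operator `p(∂/∂x_1, …, ∂/∂x_r)`. -/
def polyDiff (p : MvPolynomial (Fin r) ℂ) : Module.End ℂ (MvPolynomial (Fin r) ℂ) :=
  ∑ m ∈ p.support, p.coeff m • monomialDiff m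

/-- The `G`-invariant polynomial differential operators without constant term, as elements of
`S(V)`: here the variables are the vectors `e_j = ∂/∂x_j` of `V`, on which `g` acts by
`e_j ↦ ∑ i, g i j • e_i`. -/
def IsInvDiffSymbol (φ : Γ →* GL (Fin r) ℂ) (p : MvPolynomial (Fin r) ℂ) : Prop :=
  (∀ g : Γ, linSubst ((φ g : GL (Fin r) ℂ) : Matrix (Fin r) (Fin r) ℂ) p = p) ∧
    MvPolynomial.constantCoeff p = 0

/-- The space `C_G` of `G`-harmonic polynomials: those annihilated by all `G`-invariant
polynomial differential operators without constant term. -/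
def harmonics (φ : Γ →* GL (Fin r) ℂ) : Submodule ℂ (MvPolynomial (Fin r) ℂ) :=
  ⨅ (p : MvPolynomial (Fin r) ℂ) (_ : IsInvDiffSymbol φ p), LinearMap.ker (polyDiff p)

variable {M : Type*} [AddCommGroup M] [Module ℂ M]

/-- For a subspace `C` of `S(V^*)`, the subspace `C ⊗ M^*` of `S(V^*) ⊗ M^*`. -/
def tensorDual (M : Type*) [AddCommGroup M] [Module ℂ M]
    (C : Submodule ℂ (MvPolynomial (Fin r) ℂ)) :
    Submodule ℂ (MvPolynomial (Fin r) ℂ ⊗[ℂ] Module.Dual ℂ M) :=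
  LinearMap.range (LinearMap.rTensor (Module.Dual ℂ M) C.subtype)

/-- The dual Orlik–Solomon space `(U_M^G)^* = (C_G ⊗ M^*)^G` of a `G`-module `M`. -/
def dualOS (φ : Γ →* GL (Fin r) ℂ) (ρ : Representation ℂ Γ M) :
    Submodule ℂ (MvPolynomial (Fin r) ℂ ⊗[ℂ] Module.Dual ℂ M) :=
  tensorDual M (harmonics φ) ⊓ ((polyRep φ).tprod ρ.dual).invariants

/-- The degree-`d` part of a subspace of `S(V^*) ⊗ M^*`, graded by the polynomial degree. -/
def degPart (W : Submodule ℂ (MvPolynomial (Fin r) ℂ ⊗[ℂ] Module.Dual ℂ M)) (d : ℕ) :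
    Submodule ℂ (MvPolynomial (Fin r) ℂ ⊗[ℂ] Module.Dual ℂ M) :=
  W ⊓ tensorDual M (MvPolynomial.homogeneousSubmodule (Fin r) ℂ d)

/-- A subspace of `S(V^*) ⊗ M^*` is graded if it is spanned by its homogeneous parts. -/
def IsGraded (W : Submodule ℂ (MvPolynomial (Fin r) ℂ ⊗[ℂ] Module.Dual ℂ M)) : Prop :=
  ⨆ d, degPart W d = W

/-- The linear map `f` restricts to an isomorphism of graded vector spaces from `W` to `W'`. -/
def RestrictsToGradedIso
    (f : (MvPolynomial (Fin r) ℂ ⊗[ℂ] Module.Dual ℂ M) →ₗ[ℂ]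
      (MvPolynomial (Fin r) ℂ ⊗[ℂ] Module.Dual ℂ M))
    (W W' : Submodule ℂ (MvPolynomial (Fin r) ℂ ⊗[ℂ] Module.Dual ℂ M)) : Prop :=
  IsGraded W ∧ IsGraded W' ∧
    ∃ e : W ≃ₗ[ℂ] W', (∀ w : W, (e w : MvPolynomial (Fin r) ℂ ⊗[ℂ] Module.Dual ℂ M) = f w) ∧
      ∀ (d : ℕ) (w : W), (w : MvPolynomial (Fin r) ℂ ⊗[ℂ] Module.Dual ℂ M) ∈ degPart W d ↔
        (e w : MvPolynomial (Fin r) ℂ ⊗[ℂ] Module.Dual ℂ M) ∈ degPart W' d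

/-- The fake degree `f_M(q)`: the coefficient of `q^d` is the multiplicity of `M` in the degree-`d`
part of `C_G` (summed over the simple summands of `M`), that is, the dimension of the degree-`d`
part of `(C_G ⊗ M^*)^G = Hom_G(M, C_G)`. -/
def fakeDegree (φ : Γ →* GL (Fin r) ℂ) (ρ : Representation ℂ Γ M) : PowerSeries ℕ :=
  PowerSeries.mk fun d => Module.finrank ℂ (degPart (dualOS φ ρ) d)

/-- `E` is the multiset of `M`-exponents of `G`: `f_M(q) = ∑_{e ∈ E} q^e`. -/
def IsExponents (φ : Γ →* GL (Fin r) ℂ) (ρ : Representation ℂ Γ M) (E : Multiset ℕ) : Prop :=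
  fakeDegree φ ρ = (E.map fun e => (PowerSeries.X : PowerSeries ℕ) ^ e).sum

end General

section Twist

variable {r : ℕ} {K : Type*} [Field K] [Algebra K ℂ]

/-- The inclusion in `GL_r(ℂ)` of a subgroup of `GL_r(K)`, where `K` is embedded in `ℂ`. -/
def inclGL (G : Subgroup (GL (Fin r) K)) : G →* GL (Fin r) ℂ :=
  (Matrix.GeneralLinearGroup.map (algebraMap K ℂ)).comp G.subtype

/-- The Galois twist `V^σ`: the representation of `G` on the vector space `V = ℂ^r` obtained by
applying `σ` to the matrix entries. -/
def galoisTwist (G : Subgroup (GL (Fin r) K)) (σ : K →+* K) : Representation ℂ G (Fin r → ℂ) :=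
  natRep ((Matrix.GeneralLinearGroup.map ((algebraMap K ℂ).comp σ)).comp G.subtype)

end Twist

/-- The group `G(ab, b, r)` over the field `K`: the monomial `r × r` matrices whose nonzero entries
are `ab`-th roots of unity with product an `a`-th root of unity. The nonzero entry of column `j`
is `t j`, in row `π j`. -/
def imprimitiveGroup (K : Type*) [Field K] (a b r : ℕ) : Subgroup (GL (Fin r) K) where
  carrier := {g | ∃ (π : Equiv.Perm (Fin r)) (t : Fin r → Kˣ),
    (∀ j, t j ^ (a * b) = 1) ∧ (∏ j, t j) ^ a = 1 ∧
      ∀ i j, (g : Matrix (Fin r) (Fin r) K) i j = if i = π j then (t j : K) else 0}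
  one_mem' := by
    refine ⟨1, fun _ => 1, by simp, by simp, fun i j => ?_⟩
    by_cases h : i = j <;> simp [h]
  mul_mem' := by
    rintro g h ⟨π, t, ht, htp, hg⟩ ⟨π', t', ht', htp', hh⟩
    refine ⟨π * π', fun j => t (π' j) * t' j, fun j => ?_, ?_, fun i j => ?_⟩
    · rw [mul_pow, ht, ht', one_mul]
    · rw [Finset.prod_mul_distrib, mul_pow, Equiv.prod_comp π' t, htp, htp', one_mul]
    · rw [Units.val_mul, Matrix.mul_apply]
      simp only [hg, hh, Equiv.Perm.mul_apply, mul_ite, mul_zero, Finset.sum_ite_eq',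
        Finset.mem_univ, if_true, Units.val_mul, ite_mul, zero_mul]
      by_cases h : i = π (π' j) <;> simp [h]
  inv_mem' := by
    rintro g ⟨π, t, ht, htp, hg⟩
    refine ⟨π⁻¹, fun j => (t (π⁻¹ j))⁻¹, fun j => ?_, ?_, ?_⟩
    · rw [inv_pow, ht, inv_one]
    · rw [Finset.prod_inv_distrib, Equiv.prod_comp π⁻¹ t, inv_pow, htp, inv_one]
    · have key : (g : Matrix (Fin r) (Fin r) K) *
          Matrix.of (fun i j => if i = π⁻¹ j then (((t (π⁻¹ j))⁻¹ : Kˣ) : K) else 0) = 1 := by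
        ext i j
        rw [Matrix.mul_apply]
        simp only [hg, Matrix.of_apply, mul_ite, mul_zero, Finset.sum_ite_eq', Finset.mem_univ,
          if_true, Matrix.one_apply, ite_mul, zero_mul, Units.mul_inv]
        have hj : π (π⁻¹ j) = j := π.apply_symm_apply j
        rw [hj]
      have h2 : ((g⁻¹ : GL (Fin r) K) : Matrix (Fin r) (Fin r) K) =
          Matrix.of (fun i j => if i = π⁻¹ j then (((t (π⁻¹ j))⁻¹ : Kˣ) : K) else 0) := by
        rw [← mul_one ((g⁻¹ : GL (Fin r) K) : Matrix (Fin r) (Fin r) K), ← key, ← mul_assoc,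
          ← Units.val_mul, inv_mul_cancel, Units.val_one, one_mul]
      intro i j
      rw [h2, Matrix.of_apply]

/-- The elements `ũ_1, …, ũ_r` of `S(V^*) ⊗ (V^σ)^*`. The index `i : Fin r` stands for `i + 1`,
the coordinate function `x_j^σ` of `V^σ = ℂ^r` is `LinearMap.proj j`, and
`(x_1 ⋯ x_r)^(⌈s/a⌉ a) x_j^(-s)` is written with nonnegative exponents. -/
def uTilde (a b r s : ℕ) (i : Fin r) :
    MvPolynomial (Fin r) ℂ ⊗[ℂ] Module.Dual ℂ (Fin r → ℂ) :=
  if (i : ℕ) + 1 < r then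
    ∑ j : Fin r, (MvPolynomial.X j ^ (a * b * ((i : ℕ) + 1) - s)) ⊗ₜ[ℂ]
      (LinearMap.proj j : (Fin r → ℂ) →ₗ[ℂ] ℂ)
  else
    ∑ j : Fin r, ((∏ k ∈ Finset.univ.erase j, MvPolynomial.X k ^ (⌈(s : ℚ) / a⌉₊ * a)) *
        MvPolynomial.X j ^ (⌈(s : ℚ) / a⌉₊ * a - s)) ⊗ₜ[ℂ]
      (LinearMap.proj j : (Fin r → ℂ) →ₗ[ℂ] ℂ)

end

end ReflExp

/-! Write an element of `S(V^*) ⊗ (V^σ)^*` as `∑ f_j ⊗ x_j^σ`. Since `σ` raises every `ab`-th root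
of unity to its `s`-th power, invariance under `G` is explicit. Permutation matrices make one
component determine all the others and make `f_j` symmetric in the variables other than `x_j`.
Diagonal matrices impose congruences on the exponents in `f_j` (`GoodExp`).

Harmonics. For the Hermitian form with `⟨x^m, x^m⟩ = m!`, multiplication by a polynomial is adjoint
to the conjugate differential operator, and `G` acts unitarily. Hence `C_G` is the orthogonal
complement of `I_G^+`, and working degree by degree gives `S(V^*) = C_G ⊕ I_G^+`. The projection
commutes with `G` and with taking homogeneous components, so it suffices to show that the components
of the `ũ_i` span the invariants modulo `I_G^+` and are independent there.

Spanning (`mkQ_mem_uSpan`). Modulo `I_G^+` all elementary symmetric functions of the `y_i =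
x_i^(ab)` vanish, so a symmetric polynomial in the `y_i`, `i ≠ j`, is a polynomial in `y_j`, and
`y_j^(r-1) = ± ∏_{i ≠ j} y_i`. A monomial with all exponents at least `a` is zero, being a multiple
of the invariant `(x_1 ⋯ x_r)^a`. By the congruences, every other monomial in `f_j` is `x_j^(ab-s)`
or `x_j^(ca-s) ∏_{i ≠ j} x_i^(ca)`, with `c = ⌈s/a⌉`, times a monomial in the `y_i`. Averaging over
the permutations fixing `j` leaves these two factors times powers of `y_j`, which reduce to
components of the `ũ_i`.

Independence (`eq_zero_of_sum_mem_invIdeal`). Pairing with `(x_1 ⋯ x_r)^(a-1)` times the Vandermonde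
determinant of the `y_i`, up to scaling of coefficients, gives a functional `altCoeff` that kills
`I_G^+`. Multiplying a relation by suitable monomials isolates its coefficients one at a time. -/

namespace ReflExp

open MvPolynomial

noncomputable section

/-! ### Monomial substitutions -/

section MonSubst

variable {r : ℕ}

/-- The substitution `X_j ↦ t_(π⁻¹ j) X_(π⁻¹ j)`. -/
def monSubst (π : Equiv.Perm (Fin r)) (t : Fin r → ℂ) :
    MvPolynomial (Fin r) ℂ →ₐ[ℂ] MvPolynomial (Fin r) ℂ :=
  aeval fun j => C (t (π.symm j)) * X (π.symm j)

theorem monSubst_X (π : Equiv.Perm (Fin r)) (t : Fin r → ℂ) (j : Fin r) :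
    monSubst π t (X j) = C (t (π.symm j)) * X (π.symm j) := by
  simp [monSubst]

theorem equivMapDomain_inj (π : Equiv.Perm (Fin r)) (m n : Fin r →₀ ℕ) :
    n.equivMapDomain π.symm = m ↔ n = m.equivMapDomain π := by
  constructor
  · rintro rfl; ext i; simp [Finsupp.equivMapDomain_apply]
  · rintro rfl; ext i; simp [Finsupp.equivMapDomain_apply]

theorem monSubst_monomial (π : Equiv.Perm (Fin r)) (t : Fin r → ℂ) (n : Fin r →₀ ℕ) (c : ℂ) :
    monSubst π t (monomial n c) =
      monomial (n.equivMapDomain π.symm) ((∏ j, t j ^ (n.equivMapDomain π.symm j)) * c) := by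
  rw [monSubst, aeval_monomial, monomial_eq, Finsupp.prod_fintype _ _ (by simp),
    Finsupp.prod_fintype _ _ (by simp), ← Equiv.prod_comp π]
  simp only [Equiv.symm_apply_apply, Finsupp.equivMapDomain_apply, Equiv.symm_symm, mul_pow,
    Finset.prod_mul_distrib, algebraMap_eq, map_mul, map_prod, map_pow]
  ring

theorem coeff_monSubst (π : Equiv.Perm (Fin r)) (t : Fin r → ℂ) (f : MvPolynomial (Fin r) ℂ)
    (m : Fin r →₀ ℕ) :
    coeff m (monSubst π t f) = (∏ j, t j ^ m j) * coeff (m.equivMapDomain π) f := by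
  induction f using MvPolynomial.induction_on' with
  | add p q hp hq => rw [map_add, coeff_add, hp, hq, coeff_add, mul_add]
  | monomial n c =>
    rw [monSubst_monomial, coeff_monomial, coeff_monomial]
    by_cases h : n.equivMapDomain π.symm = m
    · rw [if_pos h, if_pos ((equivMapDomain_inj π m n).1 h), h]
    · rw [if_neg h, if_neg (fun h' => h ((equivMapDomain_inj π m n).2 h')), mul_zero]

theorem degree_equivMapDomain (π : Equiv.Perm (Fin r)) (m : Fin r →₀ ℕ) :
    (m.equivMapDomain π).degree = m.degree := by
  rw [Finsupp.degree_eq_sum, Finsupp.degree_eq_sum]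
  simp only [Finsupp.equivMapDomain_apply]
  exact Equiv.sum_comp π.symm m

theorem homogeneousComponent_monSubst (π : Equiv.Perm (Fin r)) (t : Fin r → ℂ)
    (f : MvPolynomial (Fin r) ℂ) (d : ℕ) :
    homogeneousComponent d (monSubst π t f) = monSubst π t (homogeneousComponent d f) := by
  ext m
  rw [coeff_homogeneousComponent, coeff_monSubst, coeff_monSubst, coeff_homogeneousComponent,
    degree_equivMapDomain]
  split_ifs <;> simp

theorem map_star_monSubst (π : Equiv.Perm (Fin r)) (t : Fin r → ℂ) (f : MvPolynomial (Fin r) ℂ) :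
    map (starRingEnd ℂ) (monSubst π t f) =
      monSubst π (fun j => starRingEnd ℂ (t j)) (map (starRingEnd ℂ) f) := by
  ext m
  simp [coeff_map, coeff_monSubst]

theorem linSubst_eq_monSubst {A : Matrix (Fin r) (Fin r) ℂ} (π : Equiv.Perm (Fin r))
    (t : Fin r → ℂ) (h : ∀ i j, A j i = if j = π i then t i else 0) :
    linSubst A.transpose = monSubst π t := by
  ext1 j
  simp only [linSubst, monSubst, aeval_X, Matrix.transpose_apply, h]
  rw [Finset.sum_eq_single (π.symm j)]
  · simp
  · intro i _ hi
    rw [if_neg (fun hj => hi (by simp [hj])), C_0, zero_mul]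
  · simp

end MonSubst

/-! ### The elements of the group -/

section Group

variable {a b r s : ℕ} {K : Type*} [Field K] [Algebra K ℂ]

/-- The pair `(π, t)` describes the monomial matrix `g⁻¹`. -/
def Describes (g : imprimitiveGroup K a b r) (π : Equiv.Perm (Fin r)) (t : Fin r → ℂ) : Prop :=
  ∀ i j, algebraMap K ℂ ((((g⁻¹ : imprimitiveGroup K a b r) : GL (Fin r) K) :
    Matrix (Fin r) (Fin r) K) i j) =
    if i = π j then t j else 0

theorem Describes.polyRep {g : imprimitiveGroup K a b r} {π : Equiv.Perm (Fin r)}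
    {t : Fin r → ℂ} (h : Describes g π t) (f : MvPolynomial (Fin r) ℂ) :
    polyRep (inclGL (imprimitiveGroup K a b r)) g f = monSubst π t f := by
  have := linSubst_eq_monSubst (A := ((inclGL (imprimitiveGroup K a b r) g⁻¹ :
    GL (Fin r) ℂ) : Matrix (Fin r) (Fin r) ℂ)) π t (fun i j => h j i)
  exact congrArg (fun F => F f) this

theorem exists_describes (g : imprimitiveGroup K a b r) :
    ∃ (π : Equiv.Perm (Fin r)) (t : Fin r → ℂ), (∀ j, t j ^ (a * b) = 1) ∧ (∏ j, t j) ^ a = 1 ∧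
      Describes g π t := by
  obtain ⟨π, t, ht, htp, hg⟩ := (g⁻¹).2
  refine ⟨π, fun j => algebraMap K ℂ (t j), fun j => ?_, ?_, fun i j => ?_⟩
  · rw [← map_pow, ← Units.val_pow_eq_pow_val, ht]; simp
  · have := congrArg (fun u : Kˣ => algebraMap K ℂ u) htp
    simpa using this
  · rw [hg]; split_ifs <;> simp

theorem star_eq_inv_of_pow_eq_one {n : ℕ} (hn : n ≠ 0) {z : ℂ} (hz : z ^ n = 1) :
    starRingEnd ℂ z = z⁻¹ := by
  have h1 : ‖z‖ = 1 := Complex.norm_eq_one_of_pow_eq_one hz hn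
  rw [Complex.inv_def, Complex.normSq_eq_norm_sq, h1]; simp

/-- Roots of unity are inverted by conjugation, so `g` is unitary: its matrix is the conjugate
transpose of that of `g⁻¹`. -/
theorem Describes.linSubst {g : imprimitiveGroup K a b r} {π : Equiv.Perm (Fin r)}
    {t : Fin r → ℂ} (hab : a * b ≠ 0) (ht : ∀ j, t j ^ (a * b) = 1) (h : Describes g π t) :
    linSubst ((inclGL (imprimitiveGroup K a b r) g : GL (Fin r) ℂ) :
      Matrix (Fin r) (Fin r) ℂ) = monSubst π (fun j => starRingEnd ℂ (t j)) := by
  have key : ((inclGL (imprimitiveGroup K a b r) g : GL (Fin r) ℂ) : Matrix (Fin r) (Fin r) ℂ) =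
      Matrix.of fun i j => if j = π i then starRingEnd ℂ (t i) else 0 := by
    have h2 : ((inclGL (imprimitiveGroup K a b r) g⁻¹ : GL (Fin r) ℂ) :
        Matrix (Fin r) (Fin r) ℂ) * (Matrix.of fun i j => if j = π i then starRingEnd ℂ (t i) else 0)
        = 1 := by
      ext i j
      rw [Matrix.mul_apply]
      have h3 : ∀ k, ((inclGL (imprimitiveGroup K a b r) g⁻¹ : GL (Fin r) ℂ) :
        Matrix (Fin r) (Fin r) ℂ) i k = if i = π k then t k else 0 := fun k => h i k
      simp only [h3, Matrix.of_apply, Matrix.one_apply]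
      rw [Finset.sum_eq_single (π.symm i)]
      · have ht0 : t (π.symm i) ≠ 0 := by
          intro h0; have := ht (π.symm i); rw [h0, zero_pow hab] at this; exact zero_ne_one this
        simp only [Equiv.apply_symm_apply, if_true, star_eq_inv_of_pow_eq_one hab (ht _)]
        by_cases hij : i = j
        · subst hij; simp [ht0]
        · simp [hij, Ne.symm hij]
      · intro k _ hk
        rw [if_neg (fun hj => hk (by simp [hj])), zero_mul]
      · simp
    rw [map_inv] at h2
    have h4 := congrArg (fun M => ((inclGL (imprimitiveGroup K a b r) g : GL (Fin r) ℂ) :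
        Matrix (Fin r) (Fin r) ℂ) * M) h2
    simp only [← mul_assoc, mul_one] at h4
    rw [← Units.val_mul, mul_inv_cancel, Units.val_one, one_mul] at h4
    exact h4.symm
  rw [key]
  exact linSubst_eq_monSubst (A := Matrix.of fun j i => if j = π i then starRingEnd ℂ (t i) else 0)
    π _ (fun i j => rfl)

/-- Supplies the group elements against which invariance is tested: diagonal matrices and
permutation matrices. -/
theorem describes_of (π : Equiv.Perm (Fin r)) (t : Fin r → Kˣ)
    (ht : ∀ j, t j ^ (a * b) = 1) (htp : (∏ j, t j) ^ a = 1) :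
    ∃ g : imprimitiveGroup K a b r, Describes g π (fun j => algebraMap K ℂ (t j)) := by
  let A : Matrix (Fin r) (Fin r) K := Matrix.of fun i j => if i = π j then (t j : K) else 0
  let B : Matrix (Fin r) (Fin r) K := Matrix.of fun i j => if j = π i then ((t i)⁻¹ : Kˣ) else (0 : K)
  have hAB : A * B = 1 := by
    ext i j
    rw [Matrix.mul_apply]
    simp only [A, B, Matrix.of_apply, Matrix.one_apply]
    rw [Finset.sum_eq_single (π.symm i)]
    · by_cases hij : i = j
      · subst hij; simp
      · simp [hij, Ne.symm hij]
    · intro k _ hk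
      rw [if_neg (fun hj => hk (by simp [hj])), zero_mul]
    · simp
  let g : GL (Fin r) K := ⟨A, B, hAB, mul_eq_one_comm.1 hAB⟩
  have hg : g ∈ imprimitiveGroup K a b r := ⟨π, t, ht, htp, fun i j => rfl⟩
  refine ⟨(⟨g, hg⟩ : imprimitiveGroup K a b r)⁻¹, fun i j => ?_⟩
  rw [inv_inv]
  change algebraMap K ℂ (if i = π j then (t j : K) else 0) = _
  split_ifs <;> simp

end Group

/-! ### The apolar Hermitian form -/

section Apolar

variable {r : ℕ}

/-- The Hermitian form on polynomials for which the monomials are orthogonal and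
`⟨x^m, x^m⟩ = m!`. -/
def apolar (f g : MvPolynomial (Fin r) ℂ) : ℂ :=
  ∑ m ∈ f.support, (∏ i, ((m i).factorial : ℂ)) * starRingEnd ℂ (coeff m f) * coeff m g

theorem apolar_eq_sum {f : MvPolynomial (Fin r) ℂ} (g : MvPolynomial (Fin r) ℂ)
    {s : Finset (Fin r →₀ ℕ)} (hs : f.support ⊆ s) :
    apolar f g =
      ∑ m ∈ s, (∏ i, ((m i).factorial : ℂ)) * starRingEnd ℂ (coeff m f) * coeff m g := by
  refine Finset.sum_subset hs fun m _ hm => ?_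
  rw [notMem_support_iff.1 hm]; simp

theorem apolar_add_left (f₁ f₂ g : MvPolynomial (Fin r) ℂ) :
    apolar (f₁ + f₂) g = apolar f₁ g + apolar f₂ g := by
  classical
  rw [apolar_eq_sum g (support_add (p := f₁) (q := f₂)),
    apolar_eq_sum g (Finset.subset_union_left (s₁ := f₁.support) (s₂ := f₂.support)),
    apolar_eq_sum g (Finset.subset_union_right (s₁ := f₁.support) (s₂ := f₂.support)),
    ← Finset.sum_add_distrib]
  refine Finset.sum_congr rfl fun m _ => ?_
  rw [coeff_add, map_add]; ring

theorem apolar_smul_left (c : ℂ) (f g : MvPolynomial (Fin r) ℂ) :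
    apolar (c • f) g = starRingEnd ℂ c * apolar f g := by
  rw [apolar_eq_sum g (support_smul (a := c) (f := f)), apolar, Finset.mul_sum]
  refine Finset.sum_congr rfl fun m _ => ?_
  rw [coeff_smul, smul_eq_mul, map_mul]; ring

theorem apolar_add_right (f g₁ g₂ : MvPolynomial (Fin r) ℂ) :
    apolar f (g₁ + g₂) = apolar f g₁ + apolar f g₂ := by
  simp only [apolar, coeff_add, mul_add, Finset.sum_add_distrib]

theorem apolar_smul_right (c : ℂ) (f g : MvPolynomial (Fin r) ℂ) :
    apolar f (c • g) = c * apolar f g := by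
  rw [apolar, apolar, Finset.mul_sum]
  refine Finset.sum_congr rfl fun m _ => ?_
  rw [coeff_smul, smul_eq_mul]; ring

theorem apolar_zero_left (g : MvPolynomial (Fin r) ℂ) : apolar 0 g = 0 := by
  simp [apolar]

theorem apolar_zero_right (f : MvPolynomial (Fin r) ℂ) : apolar f 0 = 0 := by
  simp [apolar]

theorem apolar_sum_left {ι : Type*} (s : Finset ι) (f : ι → MvPolynomial (Fin r) ℂ)
    (g : MvPolynomial (Fin r) ℂ) : apolar (∑ i ∈ s, f i) g = ∑ i ∈ s, apolar (f i) g :=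
  map_sum (⟨⟨fun f => apolar f g, apolar_zero_left g⟩, fun f₁ f₂ => apolar_add_left f₁ f₂ g⟩ :
    MvPolynomial (Fin r) ℂ →+ ℂ) f s

theorem apolar_sum_right {ι : Type*} (s : Finset ι) (f : MvPolynomial (Fin r) ℂ)
    (g : ι → MvPolynomial (Fin r) ℂ) : apolar f (∑ i ∈ s, g i) = ∑ i ∈ s, apolar f (g i) :=
  map_sum (⟨⟨fun g => apolar f g, apolar_zero_right f⟩, fun g₁ g₂ => apolar_add_right f g₁ g₂⟩ :
    MvPolynomial (Fin r) ℂ →+ ℂ) g s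

theorem star_apolar (f g : MvPolynomial (Fin r) ℂ) : starRingEnd ℂ (apolar g f) = apolar f g := by
  classical
  rw [apolar_eq_sum g (Finset.subset_union_left (s₁ := f.support) (s₂ := g.support)),
    apolar_eq_sum f (Finset.subset_union_right (s₁ := f.support) (s₂ := g.support)), map_sum]
  refine Finset.sum_congr rfl fun m _ => ?_
  simp only [map_mul, map_prod, Complex.conj_conj, map_natCast]
  ring

theorem apolar_self (f : MvPolynomial (Fin r) ℂ) :
    apolar f f = ((∑ m ∈ f.support, (∏ i, ((m i).factorial : ℝ)) * Complex.normSq (coeff m f) : ℝ) :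
      ℂ) := by
  rw [apolar, Complex.ofReal_sum]
  refine Finset.sum_congr rfl fun m _ => ?_
  rw [mul_assoc, ← Complex.normSq_eq_conj_mul_self]
  push_cast
  rfl

theorem eq_zero_of_apolar_self {f : MvPolynomial (Fin r) ℂ} (h : apolar f f = 0) : f = 0 := by
  rw [apolar_self, Complex.ofReal_eq_zero, Finset.sum_eq_zero_iff_of_nonneg
    (fun m _ => mul_nonneg (by positivity) (Complex.normSq_nonneg _))] at h
  rw [← support_eq_empty, Finset.eq_empty_iff_forall_notMem]
  intro m hm
  have h1 : (∏ i, ((m i).factorial : ℝ)) ≠ 0 :=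
    Finset.prod_ne_zero_iff.2 fun i _ => by positivity
  have h2 := (mul_eq_zero.1 (h m hm)).resolve_left h1
  exact mem_support_iff.1 hm (Complex.normSq_eq_zero.1 h2)

theorem apolar_monomial_left (m : Fin r →₀ ℕ) (c : ℂ) (g : MvPolynomial (Fin r) ℂ) :
    apolar (monomial m c) g = (∏ i, ((m i).factorial : ℂ)) * starRingEnd ℂ c * coeff m g := by
  classical
  rw [apolar_eq_sum g support_monomial_subset, Finset.sum_singleton, coeff_monomial, if_pos rfl]

/-- The weights `m!` are chosen for this adjointness: raising `m i` by one multiplies `m!` by `m i +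
1`, the factor produced by `∂/∂x_i`. -/
theorem apolar_X_mul (i : Fin r) (f g : MvPolynomial (Fin r) ℂ) :
    apolar (X i * f) g = apolar f (pderiv i g) := by
  induction f using MvPolynomial.induction_on' with
  | add p q hp hq => rw [mul_add, apolar_add_left, hp, hq, apolar_add_left]
  | monomial m c =>
    have h : (∏ j, (((m + Finsupp.single i 1 : Fin r →₀ ℕ) j).factorial : ℂ)) =
        (m i + 1) * ∏ j, ((m j).factorial : ℂ) := by
      rw [← Finset.mul_prod_erase _ _ (Finset.mem_univ i),
        ← Finset.mul_prod_erase _ (fun j => ((m j).factorial : ℂ)) (Finset.mem_univ i)]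
      rw [Finset.prod_congr rfl (g := fun j => ((m j).factorial : ℂ))]
      · simp [Nat.factorial_succ]; ring
      · intro j hj
        simp [Finsupp.single_eq_of_ne (Finset.ne_of_mem_erase hj)]
    rw [X, monomial_mul, one_mul, add_comm, apolar_monomial_left, apolar_monomial_left,
      coeff_pderiv, h]
    ring

theorem apolar_X_pow_mul (i : Fin r) (k : ℕ) (f g : MvPolynomial (Fin r) ℂ) :
    apolar (X i ^ k * f) g =
      apolar f (((pderiv i).toLinearMap : Module.End ℂ (MvPolynomial (Fin r) ℂ)) ^ k <| g) := by
  induction k generalizing g with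
  | zero => simp
  | succ k ih =>
    rw [pow_succ', mul_assoc, apolar_X_mul, ih, pow_succ, Module.End.mul_apply]
    rfl

theorem apolar_monomial_mul (m : Fin r →₀ ℕ) (f g : MvPolynomial (Fin r) ℂ) :
    apolar (monomial m 1 * f) g = apolar f (monomialDiff m g) := by
  have key : ∀ (l : List (Fin r)) (f : MvPolynomial (Fin r) ℂ),
      apolar ((l.map fun i => (X i : MvPolynomial (Fin r) ℂ) ^ m i).prod * f) g =
        apolar f ((l.map fun i => ((pderiv i).toLinearMap :
          Module.End ℂ (MvPolynomial (Fin r) ℂ)) ^ m i).prod g) := by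
    intro l
    induction l with
    | nil => intro f; simp
    | cons i l ih =>
      intro f
      rw [List.map_cons, List.prod_cons, List.map_cons, List.prod_cons, Module.End.mul_apply,
        ← apolar_X_pow_mul, ← ih]
      congr 1
      ring
  rw [monomialDiff, ← key, monomial_eq, Finsupp.prod_fintype _ _ (by simp), C_1, one_mul,
    ← List.prod_ofFn, List.ofFn_eq_map]

/-- The coefficients of `p` are conjugated because the form is conjugate-linear in its first
argument. -/
theorem apolar_map_star_mul (p f g : MvPolynomial (Fin r) ℂ) :
    apolar (map (starRingEnd ℂ) p * f) g = apolar f (polyDiff p g) := by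
  have h : map (starRingEnd ℂ) p =
      ∑ m ∈ p.support, starRingEnd ℂ (coeff m p) • monomial m (1 : ℂ) := by
    conv_lhs => rw [p.as_sum, map_sum]
    simp [smul_monomial]
  rw [h, polyDiff, LinearMap.sum_apply, apolar_sum_right, Finset.sum_mul, apolar_sum_left]
  refine Finset.sum_congr rfl fun m _ => ?_
  rw [smul_mul_assoc, apolar_smul_left, apolar_monomial_mul, Complex.conj_conj,
    LinearMap.smul_apply, apolar_smul_right]

theorem apolar_homogeneousComponent (d : ℕ) (f g : MvPolynomial (Fin r) ℂ) :
    apolar f (homogeneousComponent d g) = apolar (homogeneousComponent d f) g := by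
  rw [apolar_eq_sum g (f := homogeneousComponent d f) (s := f.support), apolar]
  · refine Finset.sum_congr rfl fun m _ => ?_
    rw [coeff_homogeneousComponent, coeff_homogeneousComponent]
    split_ifs <;> simp
  · rw [support_homogeneousComponent]
    exact Finset.filter_subset _ _

theorem apolar_monSubst (π : Equiv.Perm (Fin r)) {t : Fin r → ℂ}
    (ht : ∀ j, starRingEnd ℂ (t j) * t j = 1) (f g : MvPolynomial (Fin r) ℂ) :
    apolar (monSubst π t f) (monSubst π t g) = apolar f g := by
  induction f using MvPolynomial.induction_on' with
  | add p q hp hq => rw [map_add, apolar_add_left, hp, hq, apolar_add_left]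
  | monomial m c =>
    rw [monSubst_monomial, apolar_monomial_left, apolar_monomial_left, coeff_monSubst,
      ← (equivMapDomain_inj π (m.equivMapDomain π.symm) m).1 rfl]
    have h1 : (∏ i, ((m.equivMapDomain π.symm i).factorial : ℂ)) = ∏ i, ((m i).factorial : ℂ) := by
      simp only [Finsupp.equivMapDomain_apply, Equiv.symm_symm]
      exact Equiv.prod_comp π fun i => ((m i).factorial : ℂ)
    have h2 : starRingEnd ℂ (∏ j, t j ^ (m.equivMapDomain π.symm j)) *
        (∏ j, t j ^ (m.equivMapDomain π.symm j)) = 1 := by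
      rw [map_prod, ← Finset.prod_mul_distrib]
      refine Finset.prod_eq_one fun j _ => ?_
      rw [map_pow, ← mul_pow, ht, one_pow]
    rw [h1, map_mul]
    linear_combination (∏ i, ((m i).factorial : ℂ)) * starRingEnd ℂ c * coeff m g * h2

/-- Orthogonal decomposition with respect to a finite-dimensional subspace. -/
theorem exists_orthogonal_decomposition {F : Type*} [AddCommGroup F] [Module ℂ F]
    (cd : InnerProductSpace.Core ℂ F) (N : Submodule ℂ F) [FiniteDimensional ℂ N] (v : F) :
    ∃ y ∈ N, ∀ u ∈ N, cd.inner u (v - y) = 0 := by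
  let := cd.toNormedAddCommGroup
  let : InnerProductSpace ℂ F := InnerProductSpace.ofCore cd.toCore
  have : CompleteSpace N := FiniteDimensional.complete ℂ N
  obtain ⟨y, hy, z, hz, h⟩ := N.exists_add_mem_mem_orthogonal v
  refine ⟨y, hy, fun u hu => ?_⟩
  rw [h, add_sub_cancel_left]
  exact hz u hu

/-- The inner product space structure given by the apolar form. -/
@[reducible]
def apolarCore : InnerProductSpace.Core ℂ (MvPolynomial (Fin r) ℂ) where
  inner := apolar
  conj_inner_symm := star_apolar
  re_inner_nonneg f := by
    rw [apolar_self]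
    exact Finset.sum_nonneg fun m _ => mul_nonneg (by positivity) (Complex.normSq_nonneg _)
  add_left := apolar_add_left
  smul_left f g c := apolar_smul_left c f g
  definite _ := eq_zero_of_apolar_self

end Apolar

/-! ### Harmonic polynomials as the orthogonal complement of the invariant ideal -/

section Harmonic

variable {r : ℕ} {Γ : Type*} [Group Γ]

/-- The group acts by monomial matrices with entries of absolute value one. -/
def IsUnitaryMonomial (φ : Γ →* GL (Fin r) ℂ) : Prop :=
  ∀ g, ∃ (π : Equiv.Perm (Fin r)) (t : Fin r → ℂ), (∀ j, starRingEnd ℂ (t j) * t j = 1) ∧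
    (∀ f, polyRep φ g f = monSubst π t f) ∧
    linSubst ((φ g : GL (Fin r) ℂ) : Matrix (Fin r) (Fin r) ℂ) =
      monSubst π fun j => starRingEnd ℂ (t j)

variable {φ : Γ →* GL (Fin r) ℂ}

theorem homogeneousComponent_polyRep (hφ : IsUnitaryMonomial φ) (g : Γ)
    (f : MvPolynomial (Fin r) ℂ) (d : ℕ) :
    homogeneousComponent d (polyRep φ g f) = polyRep φ g (homogeneousComponent d f) := by
  obtain ⟨π, t, -, h, -⟩ := hφ g
  rw [h, h, homogeneousComponent_monSubst]

theorem map_star_map_star (p : MvPolynomial (Fin r) ℂ) :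
    map (starRingEnd ℂ) (map (starRingEnd ℂ) p) = p := by
  ext m; simp [coeff_map]

/-- By unitarity, the action of `g` on `S(V)` is the complex conjugate of its action on `S(V^*)`;
conjugating coefficients exchanges the two. -/
theorem isInvDiffSymbol_iff (hφ : IsUnitaryMonomial φ) (p : MvPolynomial (Fin r) ℂ) :
    IsInvDiffSymbol φ p ↔ map (starRingEnd ℂ) p ∈ (polyRep φ).invariants ∧
      coeff 0 (map (starRingEnd ℂ) p) = 0 := by
  rw [IsInvDiffSymbol, Representation.mem_invariants, coeff_map, constantCoeff_eq]
  refine and_congr (forall_congr' fun g => ?_) ?_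
  · obtain ⟨π, t, -, h1, h2⟩ := hφ g
    rw [h1, h2]
    have h3 := map_star_monSubst π t (map (starRingEnd ℂ) p)
    rw [map_star_map_star] at h3
    rw [← h3]
    constructor
    · intro h; conv_rhs => rw [← h, map_star_map_star]
    · intro h; rw [h, map_star_map_star]
  · simp

theorem mem_invIdeal_of_invariant (hφ : IsUnitaryMonomial φ) {p : MvPolynomial (Fin r) ℂ}
    (hp : p ∈ (polyRep φ).invariants) (h0 : coeff 0 p = 0) : p ∈ invIdeal φ := by
  rw [← sum_homogeneousComponent p]
  refine Submodule.sum_mem _ fun d _ => ?_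
  rcases Nat.eq_zero_or_pos d with rfl | hd
  · rw [homogeneousComponent_zero, h0, C_0]; exact Submodule.zero_mem _
  · refine Ideal.subset_span ⟨?_, d, hd, homogeneousComponent_isHomogeneous d p⟩
    rw [Representation.mem_invariants] at hp ⊢
    intro g
    rw [← homogeneousComponent_polyRep hφ, hp]

theorem mem_harmonics_iff (hφ : IsUnitaryMonomial φ) (g : MvPolynomial (Fin r) ℂ) :
    g ∈ harmonics φ ↔ ∀ f ∈ invIdeal φ, apolar f g = 0 := by
  simp only [harmonics, Submodule.mem_iInf, LinearMap.mem_ker]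
  constructor
  · intro hg f hf
    -- The claim is made for all multiples of `f` so that the induction on the ideal passes through
    -- multiplication by scalars of the ring.
    have key : ∀ h, apolar (h * f) g = 0 := by
      induction hf using Submodule.span_induction with
      | mem p hp =>
        intro h
        obtain ⟨hp, d, hd, hhom⟩ := hp
        have h1 := hg (map (starRingEnd ℂ) p) ((isInvDiffSymbol_iff hφ _).2 (by
          rw [map_star_map_star]
          refine ⟨hp, hhom.coeff_eq_zero ?_⟩
          simpa using hd.ne))
        rw [mul_comm, ← map_star_map_star p, apolar_map_star_mul, h1, apolar_zero_right]
      | zero => intro h; rw [mul_zero, apolar_zero_left]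
      | add x y _ _ hx hy => intro h; rw [mul_add, apolar_add_left, hx, hy, add_zero]
      | smul c x _ hx => intro h; rw [smul_eq_mul, ← mul_assoc, hx]
    simpa using key 1
  · intro hg p hp
    obtain ⟨h1, h2⟩ := (isInvDiffSymbol_iff hφ p).1 hp
    apply eq_zero_of_apolar_self
    rw [← apolar_map_star_mul]
    exact hg _ (Ideal.mul_mem_right _ _ (mem_invIdeal_of_invariant hφ h1 h2))

theorem homogeneousComponent_mem_invIdeal {f : MvPolynomial (Fin r) ℂ} (hf : f ∈ invIdeal φ)
    (d : ℕ) : homogeneousComponent d f ∈ invIdeal φ := by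
  let : GradedAlgebra (homogeneousSubmodule (Fin r) ℂ) := gradedAlgebra
  refine homogeneousComponent_mem_of_mem (Ideal.homogeneous_span _ _ ?_) hf d
  rintro p ⟨-, d, -, hp⟩
  exact ⟨d, hp⟩

theorem homogeneousComponent_mem_harmonics (hφ : IsUnitaryMonomial φ)
    {f : MvPolynomial (Fin r) ℂ} (hf : f ∈ harmonics φ) (d : ℕ) :
    homogeneousComponent d f ∈ harmonics φ := by
  rw [mem_harmonics_iff hφ] at hf ⊢
  intro p hp
  rw [apolar_homogeneousComponent]
  exact hf _ (homogeneousComponent_mem_invIdeal hp d)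

theorem polyRep_mem_invIdeal {f : MvPolynomial (Fin r) ℂ} (hf : f ∈ invIdeal φ) (g : Γ) :
    polyRep φ g f ∈ invIdeal φ := by
  let F : MvPolynomial (Fin r) ℂ →ₐ[ℂ] MvPolynomial (Fin r) ℂ :=
    linSubst ((φ g⁻¹ : GL (Fin r) ℂ) : Matrix (Fin r) (Fin r) ℂ).transpose
  change F f ∈ _
  induction hf using Submodule.span_induction with
  | mem p hp =>
    rw [show F p = p from (Representation.mem_invariants _ _).1 hp.1 g]
    exact Ideal.subset_span hp
  | zero => rw [map_zero]; exact Submodule.zero_mem _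
  | add x y _ _ hx hy => rw [map_add]; exact Submodule.add_mem _ hx hy
  | smul c x _ hx => rw [smul_eq_mul, map_mul]; exact Ideal.mul_mem_left _ _ hx

theorem polyRep_mem_harmonics (hφ : IsUnitaryMonomial φ) {f : MvPolynomial (Fin r) ℂ}
    (hf : f ∈ harmonics φ) (g : Γ) : polyRep φ g f ∈ harmonics φ := by
  rw [mem_harmonics_iff hφ] at hf ⊢
  intro p hp
  obtain ⟨π, t, ht, h, -⟩ := hφ g
  have h1 : p = polyRep φ g (polyRep φ g⁻¹ p) := by
    rw [← Module.End.mul_apply, ← map_mul, mul_inv_cancel, map_one, Module.End.one_apply]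
  rw [h1, h, h, apolar_monSubst π ht]
  exact hf _ (polyRep_mem_invIdeal hp _)

theorem isCompl_harmonics_invIdeal (hφ : IsUnitaryMonomial φ) :
    IsCompl (harmonics φ) ((invIdeal φ).restrictScalars ℂ) := by
  constructor
  · rw [Submodule.disjoint_def]
    intro f hf hf'
    exact eq_zero_of_apolar_self ((mem_harmonics_iff hφ f).1 hf f hf')
  · rw [codisjoint_iff, eq_top_iff]
    intro f _
    rw [← sum_homogeneousComponent f]
    refine Submodule.sum_mem _ fun d _ => ?_
    -- Orthogonal projection needs a finite-dimensional subspace, hence the restriction to one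
    -- degree. Different degrees are orthogonal, so orthogonality to `N` already gives orthogonality
    -- to the whole ideal.
    let N := (invIdeal φ).restrictScalars ℂ ⊓ homogeneousSubmodule (Fin r) ℂ d
    have : FiniteDimensional ℂ (homogeneousSubmodule (Fin r) ℂ d) :=
      Module.Finite.iff_fg.2 (homogeneousSubmodule_fg (Fin r) ℂ d)
    have : FiniteDimensional ℂ N := Submodule.finiteDimensional_of_le inf_le_right
    obtain ⟨y, hy, h⟩ := exists_orthogonal_decomposition apolarCore N (homogeneousComponent d f)
    rw [← sub_add_cancel (homogeneousComponent d f) y]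
    refine Submodule.add_mem_sup ?_ hy.1
    rw [mem_harmonics_iff hφ]
    intro p hp
    have h1 : homogeneousComponent d (homogeneousComponent d f - y) =
        homogeneousComponent d f - y :=
      homogeneousComponent_eq_self
        ((homogeneousComponent_isHomogeneous d f).sub hy.2)
    rw [← h1, apolar_homogeneousComponent]
    exact h _ ⟨homogeneousComponent_mem_invIdeal hp d, homogeneousComponent_isHomogeneous d p⟩

theorem projection_comm {E : Type*} [AddCommGroup E] [Module ℂ E] {p q : Submodule ℂ E}
    (h : IsCompl p q) (L : E →ₗ[ℂ] E) (hp : ∀ x ∈ p, L x ∈ p) (hq : ∀ x ∈ q, L x ∈ q) (x : E) :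
    p.projection q h (L x) = L (p.projection q h x) := by
  have h1 : x - p.projection q h x ∈ q := by
    rw [← Submodule.projection_apply_eq_zero_iff h, map_sub,
      Submodule.projection_apply_of_mem_left h (Submodule.projection_apply_mem h x), sub_self]
  have h2 := Submodule.projection_apply_of_mem_right h (hq _ h1)
  rw [map_sub, map_sub, Submodule.projection_apply_of_mem_left h
    (hp _ (Submodule.projection_apply_mem h x)), sub_eq_zero] at h2
  exact h2

theorem projection_homogeneousComponent (hφ : IsUnitaryMonomial φ)
    (hC : IsCompl (harmonics φ) ((invIdeal φ).restrictScalars ℂ)) (d : ℕ)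
    (f : MvPolynomial (Fin r) ℂ) :
    Submodule.projection _ _ hC (homogeneousComponent d f) =
      homogeneousComponent d (Submodule.projection _ _ hC f) :=
  projection_comm hC (homogeneousComponent d)
    (fun _ hx => homogeneousComponent_mem_harmonics hφ hx d)
    (fun _ hx => homogeneousComponent_mem_invIdeal hx d) f

theorem projection_polyRep (hφ : IsUnitaryMonomial φ)
    (hC : IsCompl (harmonics φ) ((invIdeal φ).restrictScalars ℂ)) (g : Γ)
    (f : MvPolynomial (Fin r) ℂ) :
    Submodule.projection _ _ hC (polyRep φ g f) = polyRep φ g (Submodule.projection _ _ hC f) :=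
  projection_comm hC (polyRep φ g) (fun _ hx => polyRep_mem_harmonics hφ hx g)
    (fun _ hx => polyRep_mem_invIdeal hx g) f

end Harmonic

theorem isUnitaryMonomial_inclGL {a b r : ℕ} {K : Type*} [Field K] [Algebra K ℂ]
    (hab : a * b ≠ 0) : IsUnitaryMonomial (inclGL (imprimitiveGroup K a b r)) := by
  intro g
  obtain ⟨π, t, ht, -, h⟩ := exists_describes g
  refine ⟨π, t, fun j => ?_, h.polyRep, h.linSubst hab ht⟩
  rw [star_eq_inv_of_pow_eq_one hab (ht j), inv_mul_cancel₀]
  intro h0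
  have := ht j
  rw [h0, zero_pow hab] at this
  exact zero_ne_one this

/-! ### Components of elements of `S(V^*) ⊗ V^*` -/

section Component

variable {r : ℕ}

/-- The `j`-th component of an element of `S(V^*) ⊗ V^*`. -/
def component (j : Fin r) :
    MvPolynomial (Fin r) ℂ ⊗[ℂ] Module.Dual ℂ (Fin r → ℂ) →ₗ[ℂ] MvPolynomial (Fin r) ℂ :=
  (TensorProduct.rid ℂ (MvPolynomial (Fin r) ℂ)).toLinearMap ∘ₗ
    LinearMap.lTensor _ (Module.Dual.eval ℂ (Fin r → ℂ) (Pi.single j 1))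

theorem component_tmul (j : Fin r) (f : MvPolynomial (Fin r) ℂ)
    (l : Module.Dual ℂ (Fin r → ℂ)) : component j (f ⊗ₜ l) = l (Pi.single j 1) • f := by
  simp [component]

theorem sum_component (w : MvPolynomial (Fin r) ℂ ⊗[ℂ] Module.Dual ℂ (Fin r → ℂ)) :
    ∑ j, component j w ⊗ₜ[ℂ] (LinearMap.proj j : (Fin r → ℂ) →ₗ[ℂ] ℂ) = w := by
  induction w with
  | zero => simp
  | add x y hx hy => simp only [map_add, TensorProduct.add_tmul, Finset.sum_add_distrib, hx, hy]
  | tmul f l =>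
    simp only [component_tmul, TensorProduct.smul_tmul]
    rw [← TensorProduct.tmul_sum]
    congr 1
    ext j
    simp [Pi.single_apply]

theorem component_ext {w w' : MvPolynomial (Fin r) ℂ ⊗[ℂ] Module.Dual ℂ (Fin r → ℂ)}
    (h : ∀ j, component j w = component j w') : w = w' := by
  rw [← sum_component w, ← sum_component w']
  simp only [h]

theorem component_sum (f : Fin r → MvPolynomial (Fin r) ℂ) (j : Fin r) :
    component j (∑ i, f i ⊗ₜ[ℂ] (LinearMap.proj i : (Fin r → ℂ) →ₗ[ℂ] ℂ)) = f j := by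
  simp only [map_sum, component_tmul]
  rw [Finset.sum_eq_single j]
  · simp
  · intro i _ hi; simp [hi]
  · simp

theorem component_rTensor (L : MvPolynomial (Fin r) ℂ →ₗ[ℂ] MvPolynomial (Fin r) ℂ) (j : Fin r)
    (w : MvPolynomial (Fin r) ℂ ⊗[ℂ] Module.Dual ℂ (Fin r → ℂ)) :
    component j (LinearMap.rTensor _ L w) = L (component j w) := by
  induction w with
  | zero => simp
  | add x y hx hy => simp only [map_add, hx, hy]
  | tmul f l => simp only [LinearMap.rTensor_tmul, component_tmul, map_smul]

theorem mem_tensorDual_iff {C : Submodule ℂ (MvPolynomial (Fin r) ℂ)}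
    {w : MvPolynomial (Fin r) ℂ ⊗[ℂ] Module.Dual ℂ (Fin r → ℂ)} :
    w ∈ tensorDual (Fin r → ℂ) C ↔ ∀ j, component j w ∈ C := by
  constructor
  · rintro ⟨v, rfl⟩ j
    induction v with
    | zero => simp
    | add x y hx hy => rw [map_add, map_add]; exact C.add_mem hx hy
    | tmul f l =>
      rw [LinearMap.rTensor_tmul, component_tmul]
      exact C.smul_mem _ f.2
  · intro h
    rw [← sum_component w]
    exact Submodule.sum_mem _ fun j _ => ⟨(⟨component j w, h j⟩ : C) ⊗ₜ LinearMap.proj j, by simp⟩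

theorem component_tprod {Γ : Type*} [Group Γ] (φ : Γ →* GL (Fin r) ℂ)
    (ρ : Representation ℂ Γ (Fin r → ℂ)) (g : Γ) (j : Fin r)
    (w : MvPolynomial (Fin r) ℂ ⊗[ℂ] Module.Dual ℂ (Fin r → ℂ)) :
    component j (((polyRep φ).tprod ρ.dual) g w) =
      ∑ i, ρ g⁻¹ (Pi.single j 1) i • polyRep φ g (component i w) := by
  induction w with
  | zero => simp
  | add x y hx hy => simp only [map_add, hx, hy, smul_add, Finset.sum_add_distrib]
  | tmul f l =>
    rw [Representation.tprod_apply, TensorProduct.map_tmul, component_tmul]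
    simp only [component_tmul, map_smul, smul_smul]
    rw [← Finset.sum_smul]
    congr 1
    rw [Representation.dual_apply, Module.Dual.transpose_apply, LinearMap.comp_apply]
    have h : ∀ v : Fin r → ℂ, l v = ∑ i, v i * l (Pi.single i 1) := by
      intro v
      conv_lhs => rw [pi_eq_sum_univ' v, map_sum]
      simp
    exact h _

end Component

/-! ### The Galois-twisted action in components -/

section Twisted

variable {a b r s : ℕ} {K : Type*} [Field K] [Algebra ℚ K] [Algebra K ℂ]

/-- Every matrix entry is zero or a power of `ζ`, and on powers of `ζ` the automorphism `σ` is the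
`s`-th power map. -/
theorem component_action {ζ : K} (hζ : IsPrimitiveRoot ζ (a * b)) (hab : a * b ≠ 0)
    {σ : K ≃ₐ[ℚ] K} (hσ : σ ζ = ζ ^ s) {g : imprimitiveGroup K a b r} {π : Equiv.Perm (Fin r)}
    {t : Fin r → ℂ} (ht : ∀ j, t j ^ (a * b) = 1) (h : Describes g π t) (j : Fin r)
    (w : MvPolynomial (Fin r) ℂ ⊗[ℂ] Module.Dual ℂ (Fin r → ℂ)) :
    component j (((polyRep (inclGL (imprimitiveGroup K a b r))).tprod
      (galoisTwist (imprimitiveGroup K a b r) (σ : K →+* K)).dual) g w) =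
      t j ^ s • monSubst π t (component (π j) w) := by
  have : NeZero (a * b) := ⟨hab⟩
  have key : ∀ i, galoisTwist (imprimitiveGroup K a b r) (σ : K →+* K) g⁻¹ (Pi.single j 1) i =
      if i = π j then t j ^ s else 0 := by
    intro i
    set x := ((((g⁻¹ : imprimitiveGroup K a b r) : GL (Fin r) K) :
      Matrix (Fin r) (Fin r) K) i j) with hx
    have h1 : galoisTwist (imprimitiveGroup K a b r) (σ : K →+* K) g⁻¹ (Pi.single j 1) i =
        algebraMap K ℂ (σ x) := by
      change (Matrix.toLin' _ (Pi.single j 1)) i = _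
      rw [Matrix.toLin'_apply, Matrix.mulVec_single_one]
      rfl
    have h2 : algebraMap K ℂ x = if i = π j then t j else 0 := h i j
    rw [h1]
    split_ifs with hi
    · rw [if_pos hi] at h2
      have h3 : x ^ (a * b) = 1 := by
        apply (algebraMap K ℂ).injective
        rw [map_pow, h2, ht, map_one]
      obtain ⟨k, -, hk⟩ := hζ.eq_pow_of_pow_eq_one h3
      rw [← h2, ← hk, map_pow, hσ, ← map_pow, ← pow_mul, ← pow_mul, mul_comm]
    · rw [if_neg hi, map_eq_zero] at h2
      rw [h2, map_zero, map_zero]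
  rw [component_tprod]
  simp only [key, h.polyRep, ite_smul, zero_smul, Finset.sum_ite_eq', Finset.mem_univ, if_true]

end Twisted

/-! ### The elements `ũ_i` -/

section UTilde

variable {r : ℕ}

/-- The exponent of the `j`-th component of `ũ_i`, with `c` standing for `⌈s / a⌉`. -/
def uExp (a b r s c : ℕ) (i j : Fin r) : Fin r →₀ ℕ :=
  if (i : ℕ) + 1 < r then Finsupp.single j (a * b * ((i : ℕ) + 1) - s)
  else Finsupp.equivFunOnFinite.symm fun k => if k = j then c * a - s else c * a

/-- The degree of `ũ_i`, with `c` standing for `⌈s / a⌉`. -/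
def uDeg (a b r s c : ℕ) (i : Fin r) : ℕ :=
  if (i : ℕ) + 1 < r then a * b * ((i : ℕ) + 1) - s else c * a * r - s

theorem component_uTilde (a b r s : ℕ) (i j : Fin r) :
    component j (uTilde a b r s i) = monomial (uExp a b r s ⌈(s : ℚ) / a⌉₊ i j) 1 := by
  rw [uTilde, uExp]
  split_ifs with h
  · rw [component_sum, X_pow_eq_monomial]
  · rw [component_sum, monomial_eq, Finsupp.prod_fintype _ _ (by simp), C_1, one_mul,
      ← Finset.mul_prod_erase _ _ (Finset.mem_univ j), mul_comm]
    congr 1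
    · simp
    · refine Finset.prod_congr rfl fun k hk => ?_
      simp [Finset.ne_of_mem_erase hk]

theorem degree_uExp {a b s c : ℕ} (hc : s ≤ c * a) (i j : Fin r) :
    (uExp a b r s c i j).degree = uDeg a b r s c i := by
  rw [uExp, uDeg]
  split_ifs with h
  · rw [Finsupp.degree_single]
  · have hr : 1 ≤ r := Nat.one_le_of_lt i.2
    obtain ⟨n, rfl⟩ : ∃ n, r = n + 1 := ⟨r - 1, by omega⟩
    rw [Finsupp.degree_eq_sum, ← Finset.add_sum_erase _ _ (Finset.mem_univ j),
      Finset.sum_congr rfl (g := fun _ => c * a)]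
    · simp
      have : c * a * (n + 1) = c * a + n * (c * a) := by ring
      omega
    · intro k hk; simp [Finset.ne_of_mem_erase hk]

theorem equivMapDomain_uExp (a b s c : ℕ) (π : Equiv.Perm (Fin r)) (i j : Fin r) :
    (uExp a b r s c i (π j)).equivMapDomain π.symm = uExp a b r s c i j := by
  ext k
  rw [Finsupp.equivMapDomain_apply, uExp, uExp]
  split_ifs with h
  · simp [Finsupp.single_apply]
  · simp

/-- The factor `t j ^ s` completes the exponents either to a multiple of `ab` at `j` alone, or to
`ca` at every index, where the condition on `∏ t j` applies. -/
theorem prod_pow_uExp {a b s c : ℕ} (hs : s ≤ a * b) (hc : s ≤ c * a) {t : Fin r → ℂ}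
    (ht : ∀ j, t j ^ (a * b) = 1) (htp : (∏ j, t j) ^ a = 1) (i j : Fin r) :
    t j ^ s * ∏ k, t k ^ uExp a b r s c i j k = 1 := by
  rw [uExp]
  split_ifs with h
  · rw [Finset.prod_eq_single j]
    · rw [Finsupp.single_eq_same, ← pow_add, Nat.add_sub_cancel', pow_mul, ht, one_pow]
      exact hs.trans (Nat.le_mul_of_pos_right _ (Nat.succ_pos _))
    · intro k _ hk; rw [Finsupp.single_eq_of_ne hk, pow_zero]
    · simp
  · rw [← Finset.mul_prod_erase _ _ (Finset.mem_univ j), ← mul_assoc,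
      Finset.prod_congr rfl (g := fun k => t k ^ (c * a))]
    · simp only [Finsupp.coe_equivFunOnFinite_symm, if_true]
      rw [← pow_add, Nat.add_sub_cancel' hc, Finset.mul_prod_erase _ (fun k => t k ^ (c * a))
        (Finset.mem_univ j), Finset.prod_pow, mul_comm c a, pow_mul, htp, one_pow]
    · intro k hk; simp [Finset.ne_of_mem_erase hk]

end UTilde

/-! ### Symmetric polynomials in all variables but one -/

section Symmetric

theorem multiset_esymm_cons_succ {R : Type*} [CommRing R] (x : R) (s : Multiset R) (k : ℕ) :
    (x ::ₘ s).esymm (k + 1) = s.esymm (k + 1) + x * s.esymm k := by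
  simp [Multiset.esymm, Multiset.powersetCard_cons, Multiset.sum_map_mul_left]

variable {r : ℕ}

theorem map_univ_eq_cons {R : Type*} (y : Fin r → R) (j : Fin r) :
    (Finset.univ : Finset (Fin r)).val.map y =
      y j ::ₘ (Finset.univ : Finset {i // i ≠ j}).val.map fun i : {i // i ≠ j} => y i := by
  have h : (Finset.univ : Finset (Fin r)) = Finset.cons j
      ((Finset.univ : Finset {i // i ≠ j}).map (Function.Embedding.subtype _)) (by simp) := by
    ext i
    simp [em]
  rw [h, Finset.cons_val, Multiset.map_cons, Finset.map_val, Multiset.map_map]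
  rfl

theorem prod_eq_mul_prod_ne {R : Type*} [CommMonoid R] (F : Fin r → R) (j : Fin r) :
    ∏ i, F i = F j * ∏ i : {i // i ≠ j}, F i := by
  rw [Finset.prod, map_univ_eq_cons F j, Multiset.prod_cons]
  rfl

variable {Q : Type*} [CommRing Q] [Algebra ℂ Q] {y : Fin r → Q}

/-- The hypothesis says `∏ (1 + y_i T) = 1`, so omitting the factor of `j` leaves `(1 + y_j T)⁻¹`.
-/
theorem aeval_esymm_ne (hy : ∀ k, 0 < k → aeval y (esymm (Fin r) ℂ k) = 0) (j : Fin r) (k : ℕ) :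
    aeval (fun i : {i // i ≠ j} => y i) (esymm {i // i ≠ j} ℂ k) = (-y j) ^ k := by
  induction k with
  | zero => simp
  | succ k ih =>
    have h := hy (k + 1) k.succ_pos
    rw [aeval_esymm_eq_multiset_esymm] at h ih ⊢
    rw [map_univ_eq_cons y j, multiset_esymm_cons_succ, ih] at h
    rw [eq_neg_of_add_eq_zero_left h]
    ring

/-- By the fundamental theorem, `P` is a polynomial in the elementary symmetric ones, whose values
are powers of `-y j`. -/
theorem exists_aeval_eq_of_isSymmetric (hy : ∀ k, 0 < k → aeval y (esymm (Fin r) ℂ k) = 0)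
    (j : Fin r) {P : MvPolynomial {i // i ≠ j} ℂ} (hP : P.IsSymmetric) :
    ∃ q : Polynomial ℂ, aeval (fun i : {i // i ≠ j} => y i) P = Polynomial.aeval (y j) q := by
  obtain ⟨p, hp⟩ := esymmAlgHom_surjective (σ := {i // i ≠ j}) ℂ
    (n := Fintype.card {i // i ≠ j}) le_rfl ⟨P, hP⟩
  refine ⟨aeval (fun i : Fin _ => (-Polynomial.X) ^ ((i : ℕ) + 1)) p, ?_⟩
  have h1 : P = aeval (fun i : Fin (Fintype.card {i // i ≠ j}) =>
      esymm {i // i ≠ j} ℂ ((i : ℕ) + 1)) p := by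
    rw [← esymmAlgHom_apply, hp]
  rw [h1]
  have h2 : (aeval fun i : {i // i ≠ j} => y i).comp
      (aeval fun i : Fin (Fintype.card {i // i ≠ j}) => esymm {i // i ≠ j} ℂ ((i : ℕ) + 1)) =
      (Polynomial.aeval (y j)).comp (aeval fun i : Fin _ => (-Polynomial.X) ^ ((i : ℕ) + 1)) := by
    ext i
    simp only [AlgHom.comp_apply, aeval_X, aeval_esymm_ne hy, map_pow, map_neg,
      Polynomial.aeval_X]
  exact congrArg (fun F => F p) h2

theorem neg_pow_eq_prod_ne (hy : ∀ k, 0 < k → aeval y (esymm (Fin r) ℂ k) = 0) (j : Fin r) :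
    (-y j) ^ (r - 1) = ∏ i : {i // i ≠ j}, y i := by
  have hcard : Fintype.card {i : Fin r // i ≠ j} = r - 1 := by simp
  rw [← aeval_esymm_ne hy, aeval_esymm_eq_multiset_esymm, Finset.esymm_map_val, ← hcard,
    ← Finset.card_univ, Finset.powersetCard_self, Finset.sum_singleton]

/-- Trades a high power of `y j` for a product over the other indices, so that divisibility by `(x_1
⋯ x_r)^a` can be used. -/
theorem mul_pow_add_eq_smul (hy : ∀ k, 0 < k → aeval y (esymm (Fin r) ℂ k) = 0) (j : Fin r)
    (z : Q) (l : ℕ) : z * y j ^ (l + (r - 1)) =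
      ((-1 : ℂ) ^ (r - 1)) • (z * y j ^ l * ∏ i : {i // i ≠ j}, y i) := by
  have h1 : ((-1 : ℂ) ^ (r - 1)) * (-1) ^ (r - 1) = 1 := by rw [← mul_pow]; simp
  rw [← neg_pow_eq_prod_ne hy, neg_pow (y j), Algebra.smul_def, pow_add]
  have h2 := congrArg (algebraMap ℂ Q) h1
  simp only [map_mul, map_pow, map_neg, map_one] at h2 ⊢
  linear_combination (-(z * y j ^ l * y j ^ (r - 1))) * h2

theorem mul_aeval_mem {U : Submodule ℂ Q} {z w : Q} (h : ∀ n : ℕ, z * w ^ n ∈ U)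
    (q : Polynomial ℂ) : z * Polynomial.aeval w q ∈ U := by
  rw [Polynomial.aeval_eq_sum_range, Finset.mul_sum]
  refine Submodule.sum_mem _ fun n _ => ?_
  rw [mul_smul_comm]
  exact U.smul_mem _ (h n)

end Symmetric

/-! ### The invariant ideal contains the basic invariants -/

section Ideal

variable {a b r : ℕ} {K : Type*} [Field K] [Algebra K ℂ]

theorem monSubst_aeval_pow {π : Equiv.Perm (Fin r)} {t : Fin r → ℂ} {n : ℕ}
    (ht : ∀ j, t j ^ n = 1) {P : MvPolynomial (Fin r) ℂ} (hP : P.IsSymmetric) :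
    monSubst π t (aeval (fun i => (X i : MvPolynomial (Fin r) ℂ) ^ n) P) =
      aeval (fun i => (X i : MvPolynomial (Fin r) ℂ) ^ n) P := by
  conv_rhs => rw [← hP π.symm, aeval_rename]
  rw [← AlgHom.comp_apply]
  congr 1
  ext1 j
  simp only [AlgHom.comp_apply, aeval_X, map_pow, monSubst_X, mul_pow, ← C_pow, ht, C_1, one_mul,
    Function.comp_apply]

theorem aeval_pow_mem_invIdeal (hab : a * b ≠ 0) {P : MvPolynomial (Fin r) ℂ}
    (hP : P.IsSymmetric) {k : ℕ} (hk : 0 < k) (hhom : P.IsHomogeneous k) :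
    aeval (fun i => (X i : MvPolynomial (Fin r) ℂ) ^ (a * b)) P ∈
      invIdeal (inclGL (imprimitiveGroup K a b r)) := by
  refine Ideal.subset_span ⟨?_, a * b * k, by positivity, hhom.aeval _ fun i => ?_⟩
  · rw [Representation.mem_invariants]
    intro g
    obtain ⟨π, t, ht, -, h⟩ := exists_describes g
    rw [h.polyRep, monSubst_aeval_pow ht hP]
  · exact isHomogeneous_X_pow i _

/-- Such a monomial is a multiple of `(x_1 ⋯ x_r)^a`, which is invariant because `(∏ t j) ^ a = 1`.
-/
theorem monomial_mem_invIdeal (ha : 0 < a) (hr : 0 < r) {m : Fin r →₀ ℕ} (hm : ∀ k, a ≤ m k)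
    (c : ℂ) : monomial m c ∈ invIdeal (inclGL (imprimitiveGroup K a b r)) := by
  let e : Fin r →₀ ℕ := Finsupp.equivFunOnFinite.symm fun _ => a
  have he : monomial e (1 : ℂ) ∈ invIdeal (inclGL (imprimitiveGroup K a b r)) := by
    refine Ideal.subset_span ⟨?_, r * a, by positivity, isHomogeneous_monomial _ ?_⟩
    · rw [Representation.mem_invariants]
      intro g
      obtain ⟨π, t, -, htp, h⟩ := exists_describes g
      have h1 : e.equivMapDomain π.symm = e := by ext i; simp [e]
      rw [h.polyRep, monSubst_monomial, h1]
      simp only [e, Finsupp.coe_equivFunOnFinite_symm, Finset.prod_pow, htp, mul_one]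
    · rw [Finsupp.degree_eq_sum]; simp [e]
  have h : monomial m c = monomial (m - e) c * monomial e 1 := by
    rw [monomial_mul, mul_one, tsub_add_cancel_of_le]
    intro k; exact hm k
  rw [h]
  exact Ideal.mul_mem_left _ _ he

end Ideal

/-! ### Spanning modulo the invariant ideal -/

section Spanning

variable {a b r s c : ℕ} {K : Type*} [Field K] [Algebra K ℂ]

theorem monomial_eq_mul_prod_ne (m : Fin r →₀ ℕ) (j : Fin r) :
    (monomial m 1 : MvPolynomial (Fin r) ℂ) = X j ^ m j * ∏ i : {i // i ≠ j}, X i.1 ^ m i := by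
  rw [monomial_eq, Finsupp.prod_fintype _ _ (by simp), C_1, one_mul,
    prod_eq_mul_prod_ne (fun i => (X i : MvPolynomial (Fin r) ℂ) ^ m i) j]

theorem mul_prod_ne_eq_monomial (j : Fin r) (e e' : ℕ) :
    (X j : MvPolynomial (Fin r) ℂ) ^ e * ∏ i : {i // i ≠ j}, X i.1 ^ e' =
      monomial (Finsupp.equivFunOnFinite.symm fun k => if k = j then e else e') 1 := by
  rw [monomial_eq_mul_prod_ne _ j]
  congr 1
  · simp
  · refine Finset.prod_congr rfl fun i _ => ?_
    simp [i.2]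

theorem esymm_isHomogeneous (k : ℕ) : (esymm (Fin r) ℂ k).IsHomogeneous k := by
  rw [esymm]
  refine IsHomogeneous.sum _ _ _ fun t ht => ?_
  have h := IsHomogeneous.prod t (fun i => (X i : MvPolynomial (Fin r) ℂ)) (fun _ => 1)
    fun i _ => isHomogeneous_X _ i
  simpa [(Finset.mem_powersetCard.1 ht).2] using h

variable (a b r K) in
/-- The quotient map of `S(V^*)` by the ideal `I_G^+`. -/
abbrev mkQ : MvPolynomial (Fin r) ℂ →ₐ[ℂ]
    MvPolynomial (Fin r) ℂ ⧸ invIdeal (inclGL (imprimitiveGroup K a b r)) :=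
  Ideal.Quotient.mkₐ ℂ _

theorem mkQ_eq_zero {f : MvPolynomial (Fin r) ℂ} :
    mkQ a b r K f = 0 ↔ f ∈ invIdeal (inclGL (imprimitiveGroup K a b r)) :=
  Ideal.Quotient.eq_zero_iff_mem

theorem aeval_mkQ_esymm (hab : a * b ≠ 0) (k : ℕ) (hk : 0 < k) :
    aeval (fun i => mkQ a b r K (X i ^ (a * b))) (esymm (Fin r) ℂ k) = 0 := by
  rw [← comp_aeval_apply, mkQ_eq_zero]
  exact aeval_pow_mem_invIdeal hab (esymm_isSymmetric _ _ _) hk (esymm_isHomogeneous k)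

variable (a b s c K) in
/-- The span of the `j`-th components of the `ũ_i`, modulo `I_G^+`. -/
def uSpan (j : Fin r) :
    Submodule ℂ (MvPolynomial (Fin r) ℂ ⧸ invIdeal (inclGL (imprimitiveGroup K a b r))) :=
  Submodule.span ℂ (Set.range fun i => mkQ a b r K (monomial (uExp a b r s c i j) 1))

theorem mkQ_uExp_mem (i j : Fin r) :
    mkQ a b r K (monomial (uExp a b r s c i j) 1) ∈ uSpan a b s c K j :=
  Submodule.subset_span ⟨i, rfl⟩

theorem uExp_last (j : Fin r) : ∃ i : Fin r, uExp a b r s c i j =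
    Finsupp.equivFunOnFinite.symm fun k => if k = j then c * a - s else c * a := by
  have hr : 1 ≤ r := Nat.one_le_of_lt j.2
  refine ⟨⟨r - 1, by omega⟩, ?_⟩
  rw [uExp, if_neg (by simp; omega)]

theorem mkQ_X_pow_mul_mem (hsab : s < a * b) (hc : s ≤ c * a)
    (hc' : c * a < s + a) (j : Fin r) (n : ℕ) :
    mkQ a b r K (X j ^ (a * b - s)) * mkQ a b r K (X j ^ (a * b)) ^ n ∈ uSpan a b s c K j := by
  have hr : 1 ≤ r := Nat.one_le_of_lt j.2
  have ha : 0 < a := Nat.pos_of_ne_zero fun h => by simp [h] at hsab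
  have hb : 0 < b := Nat.pos_of_ne_zero fun h => by simp [h] at hsab
  rcases lt_or_ge (n + 1) r with hn | hn
  · have h := mkQ_uExp_mem (a := a) (b := b) (s := s) (c := c) (K := K) ⟨n, by omega⟩ j
    rw [uExp, if_pos hn, ← X_pow_eq_monomial] at h
    rw [← map_pow, ← map_mul, ← pow_mul, ← pow_add]
    convert h using 4
    simp only [mul_add, mul_one]; omega
  · obtain ⟨l, rfl⟩ : ∃ l, n = l + (r - 1) := ⟨n - (r - 1), by omega⟩
    have h2 : mkQ a b r K (X j ^ (a * b - s)) * mkQ a b r K (X j ^ (a * b)) ^ (l + (r - 1)) =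
        ((-1 : ℂ) ^ (r - 1)) • mkQ a b r K (monomial
          (Finsupp.equivFunOnFinite.symm fun k => if k = j then a * b - s + a * b * l else a * b)
          1) := by
      have h := mul_pow_add_eq_smul (aeval_mkQ_esymm (K := K) (r := r) (a := a) (b := b)
        (by positivity)) j (mkQ a b r K (X j ^ (a * b - s))) l
      rw [h, ← mul_prod_ne_eq_monomial, pow_add, pow_mul (X j) (a * b) l, map_mul, map_mul,
        map_prod, map_pow (mkQ a b r K) (X j ^ (a * b))]
    rw [h2]
    refine Submodule.smul_mem _ _ ?_
    -- Exactly in this case is the exponent `ab - s + abl` of `x_j` below `a`; the monomial is then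
    -- the component of the last `ũ_i`. Otherwise all exponents are at least `a`.
    by_cases hl : l = 0 ∧ c = b
    · obtain ⟨rfl, rfl⟩ := hl
      obtain ⟨i, hi⟩ := uExp_last (a := a) (b := c) (s := s) (c := c) j
      have h := mkQ_uExp_mem (a := a) (b := c) (s := s) (c := c) (K := K) i j
      rw [hi] at h
      simpa only [mul_zero, add_zero, mul_comm a c] using h
    · rw [mkQ_eq_zero.2 (monomial_mem_invIdeal ha hr _ 1)]
      · exact Submodule.zero_mem _
      · intro k
        simp only [Finsupp.coe_equivFunOnFinite_symm]
        split_ifs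
        · rcases Nat.eq_zero_or_pos l with h0 | h0
          · have hcb : c < b := by
              refine lt_of_le_of_ne ?_ (fun h => hl ⟨h0, h⟩)
              by_contra hlt
              nlinarith
            have : (c + 1) * a ≤ b * a := Nat.mul_le_mul_right _ hcb
            rw [mul_comm b a, add_mul] at this
            omega
          · have : a * 1 ≤ a * b := Nat.mul_le_mul_left _ hb
            have : a * b * 1 ≤ a * b * l := Nat.mul_le_mul_left _ h0
            omega
        · exact Nat.le_mul_of_pos_right _ hb

theorem mkQ_last_mul_mem (hs : 0 < s) (hsab : s < a * b) (hc : s ≤ c * a) (j : Fin r) (n : ℕ) :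
    mkQ a b r K (X j ^ (c * a - s) * ∏ i : {i // i ≠ j}, X i.1 ^ (c * a)) *
      mkQ a b r K (X j ^ (a * b)) ^ n ∈ uSpan a b s c K j := by
  have hr : 1 ≤ r := Nat.one_le_of_lt j.2
  have ha : 0 < a := Nat.pos_of_ne_zero fun h => by simp [h] at hsab
  have hb : 0 < b := Nat.pos_of_ne_zero fun h => by simp [h] at hsab
  rcases Nat.eq_zero_or_pos n with rfl | hn
  · obtain ⟨i, hi⟩ := uExp_last (a := a) (b := b) (s := s) (c := c) j
    have h := mkQ_uExp_mem (a := a) (b := b) (s := s) (c := c) (K := K) i j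
    rw [pow_zero, mul_one, mul_prod_ne_eq_monomial, ← hi]
    exact h
  · have h1 : X j ^ (c * a - s) * (∏ i : {i // i ≠ j}, X i.1 ^ (c * a)) * (X j ^ (a * b)) ^ n =
        (X j : MvPolynomial (Fin r) ℂ) ^ (c * a - s + a * b * n) *
          ∏ i : {i // i ≠ j}, X i.1 ^ (c * a) := by
      rw [pow_add, pow_mul]; ring
    rw [← map_pow, ← map_mul, h1, mul_prod_ne_eq_monomial,
      mkQ_eq_zero.2 (monomial_mem_invIdeal ha hr _ 1)]
    · exact Submodule.zero_mem _
    · intro k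
      simp only [Finsupp.coe_equivFunOnFinite_symm]
      split_ifs
      · have : a * 1 ≤ a * b := Nat.mul_le_mul_left _ hb
        have : a * b * 1 ≤ a * b * n := Nat.mul_le_mul_left _ hn
        omega
      · refine Nat.le_mul_of_pos_left _ (Nat.pos_of_ne_zero fun h => ?_)
        simp [h] at hc; omega

/-- Permutations of the variables other than the `j`-th. -/
def renameNe (j : Fin r) (τ : Equiv.Perm {i // i ≠ j}) :
    MvPolynomial (Fin r) ℂ →ₐ[ℂ] MvPolynomial (Fin r) ℂ :=
  rename (Equiv.Perm.ofSubtype τ)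

/-- Only the last factor is moved by the permutations fixing `j`; its orbit sum is symmetric in the
`y_i`, `i ≠ j`, hence a polynomial in `y_j` modulo the ideal. -/
theorem sum_renameNe_mem (j : Fin r) (e e' l : ℕ) (ν : {i // i ≠ j} →₀ ℕ) (hab : a * b ≠ 0)
    (h : ∀ n, mkQ a b r K (X j ^ e * ∏ i : {i // i ≠ j}, X i.1 ^ e') *
      mkQ a b r K (X j ^ (a * b)) ^ n ∈ uSpan a b s c K j) :
    mkQ a b r K (∑ τ, renameNe j τ (X j ^ e * (∏ i : {i // i ≠ j}, X i.1 ^ e') *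
      (X j ^ (a * b)) ^ l * aeval (fun i : {i // i ≠ j} => (X i.1 : MvPolynomial (Fin r) ℂ) ^ (a * b))
        (monomial ν (1 : ℂ)))) ∈ uSpan a b s c K j := by
  have hj : ∀ τ : Equiv.Perm {i // i ≠ j}, Equiv.Perm.ofSubtype τ j = j := fun τ =>
    Equiv.Perm.ofSubtype_apply_of_not_mem τ (by simp)
  have h1 : ∀ τ : Equiv.Perm {i // i ≠ j},
      renameNe j τ (∏ i : {i // i ≠ j}, X i.1 ^ e') = ∏ i : {i // i ≠ j}, X i.1 ^ e' := by
    intro τ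
    rw [renameNe, map_prod, ← Equiv.prod_comp τ (fun i : {i // i ≠ j} => X i.1 ^ e')]
    refine Finset.prod_congr rfl fun i _ => ?_
    rw [map_pow, rename_X, Equiv.Perm.ofSubtype_apply_coe]
  have h2 : ∀ τ : Equiv.Perm {i // i ≠ j}, ∀ P : MvPolynomial {i // i ≠ j} ℂ,
      renameNe j τ (aeval (fun i : {i // i ≠ j} => (X i.1 : MvPolynomial (Fin r) ℂ) ^ (a * b)) P) =
        aeval (fun i : {i // i ≠ j} => (X i.1 : MvPolynomial (Fin r) ℂ) ^ (a * b)) (rename τ P) := by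
    intro τ P
    rw [aeval_rename, renameNe, comp_aeval_apply]
    congr 2
    ext1 i
    rw [map_pow, rename_X, Equiv.Perm.ofSubtype_apply_coe, Function.comp_apply]
  have h3 : (∑ τ : Equiv.Perm {i // i ≠ j}, rename τ (monomial ν (1 : ℂ))).IsSymmetric := by
    intro π
    rw [map_sum]
    conv_rhs => rw [← Equiv.sum_comp (Equiv.mulLeft π)]
    refine Finset.sum_congr rfl fun τ _ => ?_
    rw [rename_rename]
    rfl
  obtain ⟨q, hq⟩ := exists_aeval_eq_of_isSymmetric (aeval_mkQ_esymm (K := K) (r := r) hab) j h3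
  have h4 : mkQ a b r K (∑ τ, renameNe j τ (X j ^ e * (∏ i : {i // i ≠ j}, X i.1 ^ e') *
      (X j ^ (a * b)) ^ l * aeval (fun i : {i // i ≠ j} => (X i.1 : MvPolynomial (Fin r) ℂ) ^ (a * b))
        (monomial ν (1 : ℂ)))) = mkQ a b r K (X j ^ e * ∏ i : {i // i ≠ j}, X i.1 ^ e') *
      Polynomial.aeval (mkQ a b r K (X j ^ (a * b))) (Polynomial.X ^ l * q) := by
    have h5 : ∀ τ, renameNe j τ (X j) = X j := fun τ => by rw [renameNe, rename_X, hj]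
    simp only [map_mul, map_pow, h1, h2, h5]
    rw [← Finset.mul_sum, ← map_sum, map_mul, comp_aeval_apply, Polynomial.aeval_X, ← map_pow,
      ← map_pow]
    rw [← hq]
    simp only [map_mul, map_pow]
    ring
  rw [h4]
  exact mul_aeval_mem h _

/-- The condition on exponents for a monomial in the `j`-th component of an invariant. -/
def GoodExp (a b s : ℕ) (j : Fin r) (m : Fin r →₀ ℕ) : Prop :=
  (∀ i k, m i + (if i = j then s else 0) ≡ m k + (if k = j then s else 0) [MOD a * b]) ∧
    ∀ i, a ∣ m i + (if i = j then s else 0)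

/-- The common residue `ρ` of `m j + s` and the other `m i` modulo `ab` is a multiple of `a`. The
cases `ρ = 0` and `ρ ≥ a` give the two families. -/
theorem GoodExp.exists_eq (hs : 0 < s) (hsab : s < a * b) (hc : s ≤ c * a)
    (hc' : c * a < s + a) {j : Fin r} {m : Fin r →₀ ℕ} (h : GoodExp a b s j m)
    {k : Fin r} (hk : m k < a) :
    ∃ (e e' l : ℕ) (ν : {i // i ≠ j} →₀ ℕ), (e = a * b - s ∧ e' = 0 ∨ e = c * a - s ∧ e' = c * a) ∧
      m j = e + a * b * l ∧ ∀ i : {i // i ≠ j}, m i = e' + a * b * ν i := by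
  have ha : 0 < a := Nat.pos_of_ne_zero fun h => by simp [h] at hsab
  have hb : 0 < b := Nat.pos_of_ne_zero fun h => by simp [h] at hsab
  have hj : (m j + s) / (a * b) * (a * b) + (m j + s) % (a * b) = m j + s := Nat.div_add_mod' _ _
  have hi : ∀ i : {i // i ≠ j}, m i = (m j + s) % (a * b) + a * b * (m i / (a * b)) := by
    intro i
    have h1 := h.1 i j
    rw [if_neg i.2, if_pos rfl, add_zero] at h1
    rw [← h1]
    exact (Nat.mod_add_div _ _).symm
  have haj : a ∣ m j + s := by simpa using h.2 j
  have haρ : a ∣ (m j + s) % (a * b) := (Nat.dvd_mod_iff (dvd_mul_right a b)).2 haj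
  set ρ := (m j + s) % (a * b) with hρ
  set q := (m j + s) / (a * b) with hq
  rcases Nat.eq_zero_or_pos ρ with h0 | h0
  -- Here `m j + s = q * (a * b)`, and `q ≥ 1` because `s > 0`.
  · refine ⟨a * b - s, 0, q - 1, Finsupp.equivFunOnFinite.symm fun i => m i / (a * b), Or.inl ⟨rfl, rfl⟩,
      ?_, fun i => ?_⟩
    · have hq0 : q ≠ 0 := by
        intro hq0; rw [hq0, h0] at hj; omega
      obtain ⟨q', hq'⟩ := Nat.exists_eq_succ_of_ne_zero hq0
      rw [hq', Nat.succ_eq_add_one, add_mul, mul_comm q'] at hj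
      rw [hq', Nat.succ_eq_add_one, Nat.add_sub_cancel]
      omega
    · have := hi i
      rw [h0] at this
      simpa using this
  · have hρa : a ≤ ρ := Nat.le_of_dvd h0 haρ
    -- Off `j` every exponent is at least `ρ ≥ a`, so the small exponent sits at `j`.
    have hkj : k = j := by
      by_contra hkj
      have := hi ⟨k, hkj⟩
      simp only at this
      omega
    subst hkj
    obtain ⟨d, hd⟩ := haj
    -- Since `m j < a`, the multiple `a * d = m j + s` of `a` lies in `[s, s + a)`, which contains
    -- only one multiple of `a`, namely `c * a`.
    have hdc : d = c := by
      apply le_antisymm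
      · by_contra hlt
        have : (c + 1) * a ≤ d * a := Nat.mul_le_mul_right _ (by omega)
        rw [add_mul, mul_comm d] at this
        omega
      · by_contra hlt
        have : (d + 1) * a ≤ c * a := Nat.mul_le_mul_right _ (by omega)
        rw [add_mul, mul_comm d] at this
        omega
    subst hdc
    have hdb : d ≤ b := by
      by_contra hlt
      have : (b + 1) * a ≤ d * a := Nat.mul_le_mul_right _ (by omega)
      rw [add_mul, mul_comm b] at this
      omega
    have hdb' : d ≠ b := by
      rintro rfl
      rw [hρ, hd, Nat.mod_self] at h0
      exact lt_irrefl _ h0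
    have hlt : a * d < a * b := Nat.mul_lt_mul_of_pos_left (lt_of_le_of_ne hdb hdb') ha
    have hρ' : ρ = d * a := by rw [hρ, hd, Nat.mod_eq_of_lt hlt, mul_comm]
    refine ⟨d * a - s, d * a, 0, Finsupp.equivFunOnFinite.symm fun i => m i / (a * b), Or.inr ⟨rfl, rfl⟩,
      ?_, fun i => ?_⟩
    · rw [mul_comm d a, ← hd]; simp
    · have := hi i
      rw [hρ'] at this
      simpa using this

theorem mkQ_sum_renameNe_monomial_mem (hs : 0 < s) (hsab : s < a * b) (hc : s ≤ c * a)
    (hc' : c * a < s + a) {j : Fin r} {m : Fin r →₀ ℕ} (h : GoodExp a b s j m) :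
    mkQ a b r K (∑ τ, renameNe j τ (monomial m 1)) ∈ uSpan a b s c K j := by
  have hr : 1 ≤ r := Nat.one_le_of_lt j.2
  have ha : 0 < a := Nat.pos_of_ne_zero fun h => by simp [h] at hsab
  by_cases hm : ∀ k, a ≤ m k
  · have h0 : ∑ τ, renameNe j τ (monomial m 1) ∈
          invIdeal (inclGL (imprimitiveGroup K a b r)) := by
      refine Ideal.sum_mem _ fun τ _ => ?_
      rw [renameNe, rename_monomial, ← Finsupp.equivMapDomain_eq_mapDomain]
      exact monomial_mem_invIdeal ha hr (fun k => hm ((Equiv.Perm.ofSubtype τ).symm k)) 1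
    rw [mkQ_eq_zero.2 h0]
    exact Submodule.zero_mem _
  · push Not at hm
    obtain ⟨k, hk⟩ := hm
    obtain ⟨e, e', l, ν, hee, hmj, hmi⟩ := h.exists_eq hs hsab hc hc' hk
    have h1 : (monomial m 1 : MvPolynomial (Fin r) ℂ) =
        X j ^ e * (∏ i : {i // i ≠ j}, X i.1 ^ e') * (X j ^ (a * b)) ^ l *
          aeval (fun i : {i // i ≠ j} => (X i.1 : MvPolynomial (Fin r) ℂ) ^ (a * b))
            (monomial ν (1 : ℂ)) := by
      rw [monomial_eq_mul_prod_ne m j, aeval_monomial, map_one, one_mul,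
        Finsupp.prod_fintype _ _ (by simp), hmj]
      simp only [hmi, pow_add, pow_mul, Finset.prod_mul_distrib]
      ring
    rw [h1]
    refine sum_renameNe_mem j e e' l ν (by omega) fun n => ?_
    rcases hee with ⟨rfl, rfl⟩ | ⟨rfl, rfl⟩
    · simpa using mkQ_X_pow_mul_mem hsab hc hc' j n
    · exact mkQ_last_mul_mem hs hsab hc j n

/-- By symmetry `f` is the average of its images under the permutations fixing `j`, so orbit sums of
good monomials suffice. -/
theorem mkQ_mem_uSpan (hs : 0 < s) (hsab : s < a * b) (hc : s ≤ c * a)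
    (hc' : c * a < s + a) {j : Fin r} {f : MvPolynomial (Fin r) ℂ}
    (hf : ∀ m, coeff m f ≠ 0 → GoodExp a b s j m) (hsym : ∀ τ, renameNe j τ f = f) :
    mkQ a b r K f ∈ uSpan a b s c K j := by
  have h1 : (Fintype.card (Equiv.Perm {i // i ≠ j}) : ℂ) • f =
      ∑ m ∈ f.support, coeff m f • ∑ τ, renameNe j τ (monomial m 1) := by
    have h2 : ∑ τ, renameNe j τ f = (Fintype.card (Equiv.Perm {i // i ≠ j}) : ℂ) • f := by
      simp only [hsym, Finset.sum_const, Finset.card_univ, Nat.cast_smul_eq_nsmul]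
    rw [← h2]
    simp only [Finset.smul_sum]
    rw [Finset.sum_comm]
    refine Finset.sum_congr rfl fun τ _ => ?_
    conv_lhs => rw [f.as_sum, map_sum]
    refine Finset.sum_congr rfl fun m _ => ?_
    rw [← map_smul, smul_monomial, smul_eq_mul, mul_one]
  have h3 : (Fintype.card (Equiv.Perm {i // i ≠ j}) : ℂ) ≠ 0 :=
    Nat.cast_ne_zero.2 Fintype.card_ne_zero
  have h4 : mkQ a b r K ((Fintype.card (Equiv.Perm {i // i ≠ j}) : ℂ) • f) ∈
      uSpan a b s c K j := by
    rw [h1, map_sum]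
    refine Submodule.sum_mem _ fun m hm => ?_
    rw [map_smul]
    exact Submodule.smul_mem _ _
      (mkQ_sum_renameNe_monomial_mem hs hsab hc hc' (hf m (mem_support_iff.1 hm)))
  rw [map_smul] at h4
  exact (Submodule.smul_mem_iff _ h3).1 h4

end Spanning

/-! ### The conditions on exponents forced by invariance -/

section GoodExp

variable {a b r s : ℕ} {K : Type*} [Field K]

theorem goodExp_of_forall_units {ζ : K} (hζ : IsPrimitiveRoot ζ (a * b)) (hab : a * b ≠ 0)
    {j : Fin r} {m : Fin r →₀ ℕ}
    (h : ∀ t : Fin r → Kˣ, (∀ j, t j ^ (a * b) = 1) → (∏ j, t j) ^ a = 1 →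
      t j ^ s * ∏ k, t k ^ m k = 1) : GoodExp a b s j m := by
  obtain ⟨z, hz⟩ : ∃ z : Kˣ, IsPrimitiveRoot z (a * b) :=
    ⟨_, hζ.isUnit_unit hab⟩
  set m' : Fin r → ℕ := fun i => m i + if i = j then s else 0 with hm'
  have h' : ∀ t : Fin r → Kˣ, (∀ j, t j ^ (a * b) = 1) → (∏ j, t j) ^ a = 1 →
      ∏ k, t k ^ m' k = 1 := by
    intro t ht htp
    rw [← h t ht htp, mul_comm]
    simp only [hm', pow_add, Finset.prod_mul_distrib]
    congr 1
    rw [Finset.prod_eq_single j]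
    · simp
    · intro k _ hk; simp [hk]
    · simp
  have hsingle : ∀ (i : Fin r) (x : Kˣ), ∏ k, (Pi.mulSingle i x : Fin r → Kˣ) k ^ m' k =
      x ^ m' i := by
    intro i x
    rw [Finset.prod_eq_single i]
    · simp
    · intro k _ hk; simp [Pi.mulSingle_eq_of_ne hk]
    · simp
  have hprod : ∀ (i : Fin r) (x : Kˣ), ∏ k, (Pi.mulSingle i x : Fin r → Kˣ) k = x := by
    intro i x
    rw [Finset.prod_eq_single i]
    · simp
    · intro k _ hk; simp [Pi.mulSingle_eq_of_ne hk]
    · simp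
  have hpow : ∀ (i : Fin r) (x : Kˣ), x ^ (a * b) = 1 →
      ∀ k, (Pi.mulSingle i x : Fin r → Kˣ) k ^ (a * b) = 1 := by
    intro i x hx k
    by_cases hk : k = i
    · subst hk; simpa using hx
    · simp [Pi.mulSingle_eq_of_ne hk]
  constructor
  · intro i k
    -- The diagonal matrix with `z` at `i` and `z⁻¹` at `k` has determinant one and compares two
    -- exponents modulo `ab`.
    have h1 := h' (Pi.mulSingle i z * Pi.mulSingle k z⁻¹) (fun l => by
      rw [Pi.mul_apply, mul_pow, hpow i z hz.pow_eq_one,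
        hpow k z⁻¹ (by rw [inv_pow, hz.pow_eq_one, inv_one]), one_mul]) (by
      simp only [Pi.mul_apply, Finset.prod_mul_distrib, hprod]
      simp)
    simp only [Pi.mul_apply, mul_pow, Finset.prod_mul_distrib, hsingle] at h1
    rw [inv_pow, mul_inv_eq_one, pow_eq_pow_iff_modEq, ← hz.eq_orderOf] at h1
    exact h1
  · intro i
    -- A single entry `z ^ b`, a primitive `a`-th root of unity, is allowed and detects divisibility
    -- by `a`.
    have h1 := h' (Pi.mulSingle i (z ^ b)) (hpow i _ (by
      rw [← pow_mul, mul_comm, pow_mul, hz.pow_eq_one, one_pow])) (by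
      rw [hprod, ← pow_mul, mul_comm, hz.pow_eq_one])
    rw [hsingle, ← pow_mul, hz.pow_eq_one_iff_dvd, mul_comm a b] at h1
    exact Nat.dvd_of_mul_dvd_mul_left (Nat.pos_of_ne_zero (right_ne_zero_of_mul hab)) h1

variable [Algebra K ℂ]

theorem goodExp_of_coeff_ne_zero {ζ : K} (hζ : IsPrimitiveRoot ζ (a * b)) (hab : a * b ≠ 0)
    {j : Fin r} {f : MvPolynomial (Fin r) ℂ}
    (h : ∀ (g : imprimitiveGroup K a b r) (t : Fin r → ℂ), (∀ j, t j ^ (a * b) = 1) →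
      (∏ j, t j) ^ a = 1 → Describes g 1 t → t j ^ s • monSubst 1 t f = f) {m : Fin r →₀ ℕ} (hm : coeff m f ≠ 0) :
    GoodExp a b s j m := by
  refine goodExp_of_forall_units hζ hab fun t ht htp => ?_
  obtain ⟨g, hg⟩ := describes_of (1 : Equiv.Perm (Fin r)) t ht htp
  have h1 := congrArg (coeff m) (h g _ (fun j => by
    rw [← map_pow, ← Units.val_pow_eq_pow_val, ht]; simp) (by
    simpa using congrArg (fun u : Kˣ => algebraMap K ℂ u) htp) hg)
  rw [coeff_smul, coeff_monSubst, smul_eq_mul, ← mul_assoc,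
    show m.equivMapDomain (1 : Equiv.Perm (Fin r)) = m from by ext; rfl] at h1
  have h2 := mul_right_cancel₀ hm (h1.trans (one_mul _).symm)
  apply Units.ext
  apply (algebraMap K ℂ).injective
  simpa using h2

theorem monSubst_one_of_invariant {f : MvPolynomial (Fin r) ℂ}
    (hf : f ∈ (polyRep (inclGL (imprimitiveGroup K a b r))).invariants)
    (π : Equiv.Perm (Fin r)) : monSubst π (fun _ => 1) f = f := by
  obtain ⟨g, hg⟩ := describes_of (K := K) (a := a) (b := b) π (fun _ => 1) (by simp) (by simp)
  have h1 := hg.polyRep f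
  rw [(Representation.mem_invariants _ _).1 hf g] at h1
  simpa using h1.symm

theorem dvd_of_invariant {ζ : K} (hζ : IsPrimitiveRoot ζ (a * b)) (hab : a * b ≠ 0)
    {f : MvPolynomial (Fin r) ℂ}
    (hf : f ∈ (polyRep (inclGL (imprimitiveGroup K a b r))).invariants)
    {m : Fin r →₀ ℕ} (hm : coeff m f ≠ 0) :
    (∀ i k, m i ≡ m k [MOD a * b]) ∧ ∀ i, a ∣ m i := by
  have key : ∀ j, GoodExp a b 0 j m := fun j => by
    refine goodExp_of_coeff_ne_zero hζ hab (fun g t _ _ hg => ?_) hm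
    rw [pow_zero, one_smul, ← hg.polyRep]
    exact (Representation.mem_invariants _ _).1 hf g
  exact ⟨fun i k => by simpa [GoodExp] using (key i).1 i k, fun i => by simpa using (key i).2 i⟩

end GoodExp

/-! ### A linear functional vanishing on the invariant ideal -/

section Alternating

variable {a b r s c : ℕ} {K : Type*} [Field K] [Algebra K ℂ]

/-- The exponents `a - 1 + a b π(k)`. -/
def topExp (a b : ℕ) (π : Equiv.Perm (Fin r)) : Fin r →₀ ℕ :=
  Finsupp.equivFunOnFinite.symm fun k => a - 1 + a * b * (π k : ℕ)

/-- The alternating sum of the coefficients at the exponents `topExp a b π`. -/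
def altCoeff (a b : ℕ) : MvPolynomial (Fin r) ℂ →ₗ[ℂ] ℂ :=
  ∑ π : Equiv.Perm (Fin r), ((Equiv.Perm.sign π : ℤ) : ℂ) • lcoeff ℂ (topExp a b π)

theorem altCoeff_apply (a b : ℕ) (f : MvPolynomial (Fin r) ℂ) :
    altCoeff a b f =
      ∑ π : Equiv.Perm (Fin r), ((Equiv.Perm.sign π : ℤ) : ℂ) * coeff (topExp a b π) f := by
  simp [altCoeff]

/-- If the `n k` were distinct, they would be the exponents `a - 1 + ab ν(k)` for another
permutation `ν`; comparing degrees, `p` would then have a constant term. -/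
theorem exists_of_coeff_ne_zero {ζ : K} (hζ : IsPrimitiveRoot ζ (a * b)) (hab : a * b ≠ 0)
    (hr : 0 < r) {p : MvPolynomial (Fin r) ℂ}
    (hp : p ∈ (polyRep (inclGL (imprimitiveGroup K a b r))).invariants) {d : ℕ} (hd : 0 < d)
    (hhom : p.IsHomogeneous d) {n : Fin r →₀ ℕ} {c : ℂ} {π : Equiv.Perm (Fin r)}
    (h : coeff (topExp a b π) (monomial n c * p) ≠ 0) :
    ∃ i j : Fin r, i ≠ j ∧ n i = n j := by
  rw [coeff_monomial_mul'] at h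
  split_ifs at h with hn
  · have ha : 0 < a := Nat.pos_of_ne_zero (left_ne_zero_of_mul hab)
    have hμ := right_ne_zero_of_mul h
    obtain ⟨h1, h2⟩ := dvd_of_invariant hζ hab hp hμ
    set μ := topExp a b π - n with hμ_def
    have hadd : ∀ k, n k + μ k = a - 1 + a * b * (π k : ℕ) := fun k =>
      Nat.add_sub_cancel' (hn k)
    -- Where `π` takes the value `0`, the exponent `μ` is at most `a - 1` and divisible by `a`. The
    -- congruences then make every `μ k` a multiple of `ab`.
    have hzero : μ (π.symm ⟨0, hr⟩) = 0 := by
      refine Nat.eq_zero_of_dvd_of_lt (h2 _) ?_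
      have := hadd (π.symm ⟨0, hr⟩)
      rw [Equiv.apply_symm_apply] at this
      simp only [mul_zero, add_zero] at this
      omega
    have hdvd : ∀ k, a * b ∣ μ k := fun k => by
      have := h1 k (π.symm ⟨0, hr⟩)
      rw [hzero] at this
      exact (Nat.modEq_zero_iff_dvd).1 this
    choose q hq using hdvd
    by_contra! hne
    have hqle : ∀ k, q k ≤ π k := fun k => by
      by_contra! hlt
      have h3 : a * b * (π k + 1) ≤ a * b * q k := Nat.mul_le_mul_left _ hlt
      have h4 := hadd k
      have h5 : a * 1 ≤ a * b :=
        Nat.mul_le_mul_left _ (Nat.pos_of_ne_zero (right_ne_zero_of_mul hab))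
      rw [hq, mul_add] at *
      omega
    have hn' : ∀ k, n k = a - 1 + a * b * (π k - q k) := fun k => by
      have h4 := hadd k
      have h5 : a * b * q k ≤ a * b * π k := Nat.mul_le_mul_left _ (hqle k)
      rw [hq] at h4
      rw [Nat.mul_sub]
      omega
    let ν : Fin r → Fin r := fun k => ⟨π k - q k, lt_of_le_of_lt (Nat.sub_le _ _) (π k).2⟩
    have hinj : Function.Injective ν := by
      intro i j hij
      by_contra hne'
      refine hne i j hne' ?_
      rw [hn', hn', show ((π i : ℕ) - q i) = π j - q j from congrArg Fin.val hij]
    let e : Equiv.Perm (Fin r) := Equiv.ofBijective ν (Finite.injective_iff_bijective.1 hinj)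
    have hsum : ∑ k, ((π k : ℕ) - q k) = ∑ k, (π k : ℕ) :=
      (Equiv.sum_comp e (fun i : Fin r => (i : ℕ))).trans
        (Equiv.sum_comp π (fun i : Fin r => (i : ℕ))).symm
    have hq0 := (Finset.sum_eq_sum_iff_of_le fun k _ => Nat.sub_le (π k : ℕ) (q k)).1 hsum
    have hμ0 : μ = 0 := by
      ext k
      have h6 := hq0 k (Finset.mem_univ k)
      have h7 := hqle k
      have h8 : q k = 0 := by omega
      rw [hq, h8, mul_zero, Finsupp.zero_apply]
    rw [hμ0] at hμ
    refine hμ (hhom.coeff_eq_zero ?_)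
    simpa using hd.ne
  · exact absurd rfl h

/-- If some term survives, the monomial is fixed by a transposition, and so is the product with `p`;
the alternating sum then equals its own negative. -/
theorem altCoeff_monomial_mul {ζ : K} (hζ : IsPrimitiveRoot ζ (a * b)) (hab : a * b ≠ 0)
    (hr : 0 < r) {p : MvPolynomial (Fin r) ℂ}
    (hp : p ∈ (polyRep (inclGL (imprimitiveGroup K a b r))).invariants) {d : ℕ} (hd : 0 < d)
    (hhom : p.IsHomogeneous d) (n : Fin r →₀ ℕ) (c : ℂ) :
    altCoeff a b (monomial n c * p) = 0 := by
  rw [altCoeff_apply]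
  by_cases h : ∀ π, coeff (topExp a b π) (monomial n c * p) = 0
  · simp [h]
  · push Not at h
    obtain ⟨π, hπ⟩ := h
    obtain ⟨i, j, hij, hn⟩ := exists_of_coeff_ne_zero hζ hab hr hp hd hhom hπ
    have hsymm : (Equiv.swap i j).symm = Equiv.swap i j := Equiv.symm_swap i j
    have h1 : n.equivMapDomain (Equiv.swap i j).symm = n := by
      ext k
      rw [Finsupp.equivMapDomain_apply, Equiv.symm_symm]
      by_cases hki : k = i
      · subst hki; rw [Equiv.swap_apply_left, hn]
      · by_cases hkj : k = j
        · subst hkj; rw [Equiv.swap_apply_right, hn]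
        · rw [Equiv.swap_apply_of_ne_of_ne hki hkj]
    have h2 : monSubst (Equiv.swap i j) (fun _ => 1) (monomial n c * p) = monomial n c * p := by
      rw [map_mul, monSubst_one_of_invariant hp, monSubst_monomial, h1]
      simp
    have h3 : ∀ π : Equiv.Perm (Fin r), coeff (topExp a b (π * Equiv.swap i j)) (monomial n c * p) =
        coeff (topExp a b π) (monomial n c * p) := by
      intro π
      conv_rhs => rw [← h2, coeff_monSubst]
      simp only [one_pow, Finset.prod_const_one, one_mul]
      congr 1
      ext k
      rw [Finsupp.equivMapDomain_apply, hsymm]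
      rfl
    have h4 := Equiv.sum_comp (Equiv.mulRight (Equiv.swap i j)) fun π : Equiv.Perm (Fin r) =>
      ((Equiv.Perm.sign π : ℤ) : ℂ) * coeff (topExp a b π) (monomial n c * p)
    simp only [Equiv.coe_mulRight, h3, Equiv.Perm.sign_mul, Equiv.Perm.sign_swap hij] at h4
    simp only [mul_neg, mul_one, Units.val_neg, Int.cast_neg, neg_mul,
      Finset.sum_neg_distrib] at h4
    exact self_eq_neg.1 h4.symm

theorem altCoeff_eq_zero {ζ : K} (hζ : IsPrimitiveRoot ζ (a * b)) (hab : a * b ≠ 0)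
    (hr : 0 < r) {f : MvPolynomial (Fin r) ℂ}
    (hf : f ∈ invIdeal (inclGL (imprimitiveGroup K a b r))) : altCoeff a b f = 0 := by
  have key : ∀ h : MvPolynomial (Fin r) ℂ, altCoeff a b (h * f) = 0 := by
    induction hf using Submodule.span_induction with
    | mem p hp =>
      intro h
      obtain ⟨hp, d, hd, hhom⟩ := hp
      rw [h.as_sum, Finset.sum_mul, map_sum]
      exact Finset.sum_eq_zero fun m _ => altCoeff_monomial_mul hζ hab hr hp hd hhom m _
    | zero => intro h; rw [mul_zero, map_zero]
    | add x y _ _ hx hy => intro h; rw [mul_add, map_add, hx, hy, add_zero]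
    | smul c x _ hx => intro h; rw [smul_eq_mul, ← mul_assoc, hx]
  simpa using key 1

theorem altCoeff_topExp (hab : a * b ≠ 0) (π : Equiv.Perm (Fin r)) :
    altCoeff a b (monomial (topExp a b π) 1) ≠ 0 := by
  classical
  rw [altCoeff_apply, Finset.sum_eq_single π]
  · simp
  · intro τ _ hτ
    rw [coeff_monomial, if_neg, mul_zero]
    intro h
    refine hτ (Equiv.ext fun k => ?_)
    have h1 : a - 1 + a * b * (π k : ℕ) = a - 1 + a * b * (τ k : ℕ) := DFunLike.congr_fun h k
    exact Fin.ext (Nat.eq_of_mul_eq_mul_left (Nat.pos_of_ne_zero hab) (Nat.add_left_cancel h1)).symm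
  · simp

theorem altCoeff_of_degree_ne {m : Fin r →₀ ℕ} {π : Equiv.Perm (Fin r)}
    (hm : m.degree ≠ (topExp a b π).degree) : altCoeff a b (monomial m 1) = 0 := by
  classical
  rw [altCoeff_apply]
  refine Finset.sum_eq_zero fun τ _ => ?_
  rw [coeff_monomial, if_neg, mul_zero]
  rintro rfl
  refine hm ?_
  rw [Finsupp.degree_eq_sum, Finsupp.degree_eq_sum]
  exact (Equiv.sum_comp τ fun i : Fin r => a - 1 + a * b * (i : ℕ)).trans
    (Equiv.sum_comp π fun i : Fin r => a - 1 + a * b * (i : ℕ)).symm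

theorem altCoeff_mul_sum {ι : Type*} (s : Finset ι) (w : Fin r →₀ ℕ) (l : ι → ℂ)
    (u : ι → Fin r →₀ ℕ) : altCoeff a b (monomial w 1 * ∑ i ∈ s, l i • monomial (u i) (1 : ℂ)) =
      ∑ i ∈ s, l i * altCoeff a b (monomial (w + u i) 1) := by
  simp only [Finset.mul_sum, map_sum, mul_smul_comm, map_smul, smul_eq_mul, monomial_mul, mul_one]

/-- Multiplying the relation by the monomial that completes the `i`-th term to `topExp a b π` and
applying `altCoeff` isolates `l i`, for a suitable `π`. -/
theorem eq_zero_of_sum_mem_invIdeal {ζ : K} (hζ : IsPrimitiveRoot ζ (a * b)) (hs : 0 < s)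
    (hsab : s < a * b) (hc : s ≤ c * a) (hc' : c * a < s + a) (j : Fin r) {l : Fin r → ℂ}
    (h : ∑ i, l i • monomial (uExp a b r s c i j) (1 : ℂ) ∈
      invIdeal (inclGL (imprimitiveGroup K a b r))) : l = 0 := by
  have hr : 0 < r := Nat.zero_lt_of_lt j.2
  have hab : a * b ≠ 0 := by omega
  have ha : 0 < a := Nat.pos_of_ne_zero (left_ne_zero_of_mul hab)
  have hb : 0 < b := Nat.pos_of_ne_zero (right_ne_zero_of_mul hab)
  have hc1 : 0 < c := Nat.pos_of_ne_zero fun h0 => by rw [h0] at hc; omega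
  have hcb : c ≤ b := by
    by_contra! hlt
    have : (b + 1) * a ≤ c * a := Nat.mul_le_mul_right _ hlt
    rw [add_mul, mul_comm b] at this
    omega
  have hvanish : ∀ w : Fin r →₀ ℕ,
      ∑ i, l i * altCoeff a b (monomial (w + uExp a b r s c i j) 1) = 0 := fun w => by
    rw [← altCoeff_mul_sum]
    exact altCoeff_eq_zero hζ hab hr (Ideal.mul_mem_left _ _ h)
  have hfirst : ∀ i : Fin r, (i : ℕ) + 1 < r → l i = 0 := by
    intro i hi
    -- Giving `x_j` the largest exponent makes room for every pure power of `x_j` in the list.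
    let π : Equiv.Perm (Fin r) := Equiv.swap j ⟨r - 1, by omega⟩
    have hπ : ((π j : Fin r) : ℕ) = r - 1 := by simp [π]
    have hbound : a * b * ((i : ℕ) + 1) ≤ a * b * (r - 1) := Nat.mul_le_mul_left _ (by omega)
    have htop : topExp a b π j = a - 1 + a * b * (r - 1) := by
      change a - 1 + a * b * ((π j : Fin r) : ℕ) = _
      rw [hπ]
    have hle : uExp a b r s c i j ≤ topExp a b π := by
      rw [uExp, if_pos hi, Finsupp.single_le_iff, htop]
      omega
    have hv := hvanish (topExp a b π - uExp a b r s c i j)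
    rw [Finset.sum_eq_single i] at hv
    · rw [tsub_add_cancel_of_le hle] at hv
      exact (mul_eq_zero.1 hv).resolve_right (altCoeff_topExp hab π)
    · intro i' _ hi'
      by_cases hlast : (i' : ℕ) + 1 < r
      · rw [altCoeff_of_degree_ne (π := π), mul_zero]
        conv_rhs => rw [← tsub_add_cancel_of_le hle]
        rw [map_add, map_add, degree_uExp hc, degree_uExp hc, uDeg, uDeg, if_pos hi, if_pos hlast]
        intro heq
        refine hi' (Fin.ext ?_)
        have h1 : a * b * 1 ≤ a * b * ((i : ℕ) + 1) := Nat.mul_le_mul_left _ (by omega)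
        have h2 : a * b * 1 ≤ a * b * ((i' : ℕ) + 1) := Nat.mul_le_mul_left _ (by omega)
        have h3 : a * b * ((i' : ℕ) + 1) = a * b * ((i : ℕ) + 1) := by omega
        have h4 := Nat.eq_of_mul_eq_mul_left (by omega) h3
        omega
      -- The last term may have the same degree, but its product lies in the ideal: the exponent at
      -- `j` is at least `a - 1 + s ≥ a`, and elsewhere at least `ca ≥ a`.
      · rw [altCoeff_eq_zero hζ hab hr (monomial_mem_invIdeal ha hr (fun k => ?_) 1), mul_zero]
        rw [Finsupp.add_apply]
        have h1 : 1 * a ≤ c * a := Nat.mul_le_mul_right _ hc1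
        by_cases hk : k = j
        · subst hk
          have h2 : a * b * 1 ≤ a * b * ((i : ℕ) + 1) := Nat.mul_le_mul_left _ (by omega)
          rw [Finsupp.tsub_apply, htop, uExp, if_pos hi, Finsupp.single_eq_same]
          omega
        · rw [show uExp a b r s c i' j k = c * a by rw [uExp, if_neg hlast]; simp [hk]]
          omega
    · simp
  funext i
  rw [Pi.zero_apply]
  by_cases hi : (i : ℕ) + 1 < r
  · exact hfirst i hi
  -- Now `x_j` gets the smallest exponent `a - 1`, which still bounds `ca - s`; the other exponents
  -- are at least `ab ≥ ca`.
  · let π : Equiv.Perm (Fin r) := Equiv.swap j ⟨0, hr⟩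
    have hle : uExp a b r s c i j ≤ topExp a b π := by
      intro k
      rw [uExp, if_neg hi]
      change (if k = j then c * a - s else c * a) ≤ a - 1 + a * b * ((π k : Fin r) : ℕ)
      split_ifs with hk
      · omega
      · have h1 : 0 < ((π k : Fin r) : ℕ) := by
          refine Nat.pos_of_ne_zero fun h0 => hk ?_
          have h2 : π k = ⟨0, hr⟩ := Fin.ext h0
          rw [Equiv.swap_apply_eq_iff, Equiv.swap_apply_right] at h2
          exact h2
        have h3 : a * b * 1 ≤ a * b * ((π k : Fin r) : ℕ) := Nat.mul_le_mul_left _ h1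
        have h4 : a * c ≤ a * b := Nat.mul_le_mul_left _ hcb
        rw [mul_comm c a]
        omega
    have hv := hvanish (topExp a b π - uExp a b r s c i j)
    rw [Finset.sum_eq_single i] at hv
    · rw [tsub_add_cancel_of_le hle] at hv
      exact (mul_eq_zero.1 hv).resolve_right (altCoeff_topExp hab π)
    · intro i' _ hi'
      rw [hfirst i' ?_, zero_mul]
      by_contra hlast
      exact hi' (Fin.ext (by omega))
    · simp

end Alternating

/-! ### Graded subspaces spanned by homogeneous elements -/

section Graded

variable {r : ℕ}

local notation "SV" => MvPolynomial (Fin r) ℂ ⊗[ℂ] Module.Dual ℂ (Fin r → ℂ)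

/-- The projection of `S(V^*) ⊗ V^*` to its part of degree `d`. -/
def degProj (d : ℕ) : SV →ₗ[ℂ] SV := LinearMap.rTensor _ (homogeneousComponent d)

theorem mem_tensorDual_homogeneous_iff {d : ℕ} {w : SV} :
    w ∈ tensorDual (Fin r → ℂ) (homogeneousSubmodule (Fin r) ℂ d) ↔ degProj d w = w := by
  rw [mem_tensorDual_iff]
  constructor
  · intro h
    refine component_ext fun j => ?_
    rw [degProj, component_rTensor, homogeneousComponent_eq_self (h j)]
  · intro h j
    rw [← h, degProj, component_rTensor]
    exact homogeneousComponent_isHomogeneous d _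

theorem degProj_of_mem {d e : ℕ} {w : SV}
    (hw : w ∈ tensorDual (Fin r → ℂ) (homogeneousSubmodule (Fin r) ℂ e)) :
    degProj d w = if e = d then w else 0 := by
  split_ifs with h
  · subst h; exact mem_tensorDual_homogeneous_iff.1 hw
  · refine component_ext fun j => ?_
    rw [degProj, component_rTensor, homogeneousComponent_of_mem (mem_tensorDual_iff.1 hw j),
      if_neg (Ne.symm h), map_zero]

variable {ι : Type*} {deg : ι → ℕ}

theorem isGraded_span {u : ι → SV}
    (hu : ∀ i, u i ∈ tensorDual (Fin r → ℂ) (homogeneousSubmodule (Fin r) ℂ (deg i))) :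
    IsGraded (Submodule.span ℂ (Set.range u)) := by
  refine le_antisymm (iSup_le fun d => inf_le_left) (Submodule.span_le.2 ?_)
  rintro _ ⟨i, rfl⟩
  exact (le_iSup (fun d => degPart (Submodule.span ℂ (Set.range u)) d) (deg i))
    ⟨Submodule.subset_span ⟨i, rfl⟩, hu i⟩

variable [Fintype ι]

theorem degProj_sum {u : ι → SV}
    (hu : ∀ i, u i ∈ tensorDual (Fin r → ℂ) (homogeneousSubmodule (Fin r) ℂ (deg i)))
    (d : ℕ) (l : ι → ℂ) :
    degProj d (∑ i, l i • u i) = ∑ i : {i // deg i = d}, l i • u i := by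
  classical
  rw [map_sum, ← Finset.sum_subtype (Finset.univ.filter fun i => deg i = d) (by simp)
    (fun i => l i • u i), Finset.sum_filter]
  refine Finset.sum_congr rfl fun i _ => ?_
  rw [map_smul, degProj_of_mem (hu i), smul_ite, smul_zero]

theorem degPart_span {u : ι → SV}
    (hu : ∀ i, u i ∈ tensorDual (Fin r → ℂ) (homogeneousSubmodule (Fin r) ℂ (deg i))) (d : ℕ) :
    degPart (Submodule.span ℂ (Set.range u)) d =
      Submodule.span ℂ (Set.range fun i : {i // deg i = d} => u i) := by
  classical
  refine le_antisymm ?_ (Submodule.span_le.2 ?_)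
  · rintro w ⟨hw, hd⟩
    obtain ⟨l, rfl⟩ := (Submodule.mem_span_range_iff_exists_fun ℂ).1 hw
    rw [SetLike.mem_coe, mem_tensorDual_homogeneous_iff, degProj_sum hu] at hd
    rw [← hd]
    exact Submodule.sum_mem _ fun i _ => Submodule.smul_mem _ _ (Submodule.subset_span ⟨i, rfl⟩)
  · rintro _ ⟨⟨i, rfl⟩, rfl⟩
    exact ⟨Submodule.subset_span ⟨i, rfl⟩, hu i⟩

theorem finrank_degPart_span {u : ι → SV}
    (hu : ∀ i, u i ∈ tensorDual (Fin r → ℂ) (homogeneousSubmodule (Fin r) ℂ (deg i)))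
    (hli : LinearIndependent ℂ u) (d : ℕ) :
    Module.finrank ℂ (degPart (Submodule.span ℂ (Set.range u)) d) =
      Fintype.card {i // deg i = d} := by
  rw [degPart_span hu]
  exact finrank_span_eq_card (hli.comp _ Subtype.val_injective)

theorem restrictsToGradedIso_span {u : ι → SV}
    (hu : ∀ i, u i ∈ tensorDual (Fin r → ℂ) (homogeneousSubmodule (Fin r) ℂ (deg i)))
    {f : SV →ₗ[ℂ] SV} (hf : ∀ d w, degProj d (f w) = f (degProj d w))
    (hli : LinearIndependent ℂ fun i => f (u i)) :
    RestrictsToGradedIso f (Submodule.span ℂ (Set.range u))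
      (Submodule.span ℂ (Set.range fun i => f (u i))) := by
  classical
  have hfu : ∀ i, f (u i) ∈ tensorDual (Fin r → ℂ) (homogeneousSubmodule (Fin r) ℂ (deg i)) := by
    intro i
    rw [mem_tensorDual_homogeneous_iff, hf, mem_tensorDual_homogeneous_iff.1 (hu i)]
  have hmap : (Submodule.span ℂ (Set.range u)).map f =
      Submodule.span ℂ (Set.range fun i => f (u i)) := by
    rw [Submodule.map_span, ← Set.range_comp]; rfl
  have hinj : ∀ w ∈ Submodule.span ℂ (Set.range u), f w = 0 → w = 0 := by
    intro w hw h0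
    obtain ⟨l, rfl⟩ := (Submodule.mem_span_range_iff_exists_fun ℂ).1 hw
    simp only [map_sum, map_smul] at h0
    have := Fintype.linearIndependent_iff.1 hli l h0
    simp [this]
  have hmem : ∀ w ∈ Submodule.span ℂ (Set.range u),
      f w ∈ Submodule.span ℂ (Set.range fun i => f (u i)) := fun w hw => by
    rw [← hmap]; exact Submodule.mem_map_of_mem hw
  refine ⟨isGraded_span hu, isGraded_span hfu,
    LinearEquiv.ofBijective (f.restrict hmem) ⟨?_, ?_⟩, fun w => rfl, fun d w => ?_⟩
  · refine (injective_iff_map_eq_zero _).2 fun w hw => ?_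
    exact Subtype.ext (hinj w w.2 (congrArg Subtype.val hw))
  · rintro ⟨v, hv⟩
    rw [← hmap] at hv
    obtain ⟨w, hw, rfl⟩ := hv
    exact ⟨⟨w, hw⟩, rfl⟩
  · have h1 : (w : SV) ∈ degPart (Submodule.span ℂ (Set.range u)) d ↔ degProj d (w : SV) = w := by
      rw [degPart, Submodule.mem_inf, mem_tensorDual_homogeneous_iff]
      exact and_iff_right w.2
    have h2 : f w ∈ degPart (Submodule.span ℂ (Set.range fun i => f (u i))) d ↔
        degProj d (f w) = f w := by
      rw [degPart, Submodule.mem_inf, mem_tensorDual_homogeneous_iff]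
      exact and_iff_right (hmem w w.2)
    refine h1.trans (Iff.trans ?_ h2.symm)
    constructor
    · intro h; rw [hf, h]
    · intro h
      -- Reflecting the degree uses injectivity of `f` on the span, which contains `degProj d w`
      -- because the `u i` are homogeneous.
      rw [← sub_eq_zero]
      refine hinj _ (Submodule.sub_mem _ ?_ w.2) ?_
      · obtain ⟨l, hl⟩ := (Submodule.mem_span_range_iff_exists_fun ℂ).1 w.2
        rw [← hl, degProj_sum hu]
        exact Submodule.sum_mem _ fun i _ => Submodule.smul_mem _ _ (Submodule.subset_span ⟨i, rfl⟩)
      · rw [map_sub, ← hf, h, sub_self]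

end Graded

/-! ### The dual Orlik–Solomon space -/

section Main

variable {a b r s : ℕ} {K : Type*} [Field K] [Algebra K ℂ] {ζ : K}

local notation "φ" => inclGL (imprimitiveGroup K a b r)
local notation "SV" => MvPolynomial (Fin r) ℂ ⊗[ℂ] Module.Dual ℂ (Fin r → ℂ)

/-- These bounds characterise `⌈s / a⌉ * a` as the only multiple of `a` in `[s, s + a)`. -/
theorem ceil_bounds (ha : 0 < a) :
    s ≤ ⌈(s : ℚ) / a⌉₊ * a ∧ ⌈(s : ℚ) / a⌉₊ * a < s + a := by
  have ha' : (0 : ℚ) < a := by exact_mod_cast ha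
  constructor
  · have h := Nat.le_ceil ((s : ℚ) / a)
    rw [div_le_iff₀ ha'] at h
    exact_mod_cast h
  · have h := Nat.ceil_lt_add_one (a := (s : ℚ) / a) (by positivity)
    rw [← sub_lt_iff_lt_add, lt_div_iff₀ ha', sub_mul, one_mul, sub_lt_iff_lt_add] at h
    exact_mod_cast h

/-! ### Invariants of the twisted representation -/

section Twisted

variable [Algebra ℚ K] {σ : K ≃ₐ[ℚ] K}

local notation "ρ" => galoisTwist (imprimitiveGroup K a b r) (σ : K →+* K)

theorem mem_invariants_iff (hζ : IsPrimitiveRoot ζ (a * b)) (hab : a * b ≠ 0) (hσ : σ ζ = ζ ^ s)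
    {w : SV} : w ∈ ((polyRep φ).tprod (ρ).dual).invariants ↔
      ∀ (g : imprimitiveGroup K a b r) (π : Equiv.Perm (Fin r)) (t : Fin r → ℂ),
        (∀ j, t j ^ (a * b) = 1) → (∏ j, t j) ^ a = 1 → Describes g π t →
          ∀ j, t j ^ s • monSubst π t (component (π j) w) = component j w := by
  rw [Representation.mem_invariants]
  constructor
  · intro h g π t ht _ hg j
    rw [← component_action hζ hab hσ ht hg, h]
  · intro h g
    obtain ⟨π, t, ht, htp, hg⟩ := exists_describes g
    refine component_ext fun j => ?_
    rw [component_action hζ hab hσ ht hg, h g π t ht htp hg]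

theorem uTilde_mem_invariants (hζ : IsPrimitiveRoot ζ (a * b)) (ha : 0 < a) (hsab : s < a * b)
    (hσ : σ ζ = ζ ^ s) (i : Fin r) :
    uTilde a b r s i ∈ ((polyRep φ).tprod (ρ).dual).invariants := by
  rw [mem_invariants_iff hζ (by omega) hσ]
  intro g π t ht htp _ j
  rw [component_uTilde, component_uTilde, monSubst_monomial, equivMapDomain_uExp, smul_monomial,
    mul_one, smul_eq_mul, prod_pow_uExp hsab.le (ceil_bounds ha).1 ht htp]

theorem rTensor_projection_mem_dualOS (hζ : IsPrimitiveRoot ζ (a * b)) (hab : a * b ≠ 0)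
    (hσ : σ ζ = ζ ^ s) (hC : IsCompl (harmonics φ) ((invIdeal φ).restrictScalars ℂ)) {w : SV}
    (hw : w ∈ ((polyRep φ).tprod (ρ).dual).invariants) :
    LinearMap.rTensor (Module.Dual ℂ (Fin r → ℂ)) (Submodule.projection _ _ hC) w ∈
      dualOS φ ρ := by
  refine ⟨mem_tensorDual_iff.2 fun j => ?_, ?_⟩
  · rw [component_rTensor]
    exact Submodule.projection_apply_mem hC _
  · rw [SetLike.mem_coe, mem_invariants_iff hζ hab hσ] at *
    intro g π t ht htp hg j
    rw [component_rTensor, component_rTensor, ← hw g π t ht htp hg j, map_smul, ← hg.polyRep,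
      ← hg.polyRep, projection_polyRep (isUnitaryMonomial_inclGL hab)]

/-- The coefficients are found from one component. The difference is again invariant, so
transpositions carry membership in the ideal to all other components. -/
theorem exists_sum_sub_mem_invIdeal (hζ : IsPrimitiveRoot ζ (a * b)) (hr : 0 < r) (hs : 0 < s)
    (hsab : s < a * b) (hσ : σ ζ = ζ ^ s) {w : SV}
    (hw : w ∈ ((polyRep φ).tprod (ρ).dual).invariants) :
    ∃ l : Fin r → ℂ, ∀ j, component j (w - ∑ i, l i • uTilde a b r s i) ∈ invIdeal φ := by
  have hab : a * b ≠ 0 := by omega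
  have ha : 0 < a := Nat.pos_of_ne_zero (left_ne_zero_of_mul hab)
  obtain ⟨hc, hc'⟩ := ceil_bounds (s := s) ha
  have hw' := (mem_invariants_iff hζ hab hσ).1 hw
  let j₀ : Fin r := ⟨0, hr⟩
  have hperm : ∀ (π : Equiv.Perm (Fin r)) (v : SV),
      v ∈ ((polyRep φ).tprod (ρ).dual).invariants → ∀ j,
        monSubst π (fun _ => 1) (component (π j) v) = component j v := by
    intro π v hv j
    obtain ⟨g, hg⟩ := describes_of (K := K) (a := a) (b := b) π (fun _ => 1) (by simp) (by simp)
    simpa using (mem_invariants_iff hζ hab hσ).1 hv g π _ (by simp) (by simp) hg j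
  have hmem : mkQ a b r K (component j₀ w) ∈ uSpan a b s ⌈(s : ℚ) / a⌉₊ K j₀ := by
    refine mkQ_mem_uSpan hs hsab hc hc' (fun m hm => ?_) fun τ => ?_
    · refine goodExp_of_coeff_ne_zero hζ hab (fun g t ht htp hg => ?_) hm
      exact hw' g 1 t ht htp hg j₀
    · have h1 := hperm (Equiv.Perm.ofSubtype τ).symm w hw j₀
      have h2 : (Equiv.Perm.ofSubtype τ).symm j₀ = j₀ := by
        rw [Equiv.symm_apply_eq, Equiv.Perm.ofSubtype_apply_of_not_mem τ (by simp)]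
      rw [h2] at h1
      conv_rhs => rw [← h1]
      rw [renameNe]
      refine congrArg (fun F => F (component j₀ w)) (?_ : rename _ = monSubst _ _)
      ext1 k
      rw [rename_X, monSubst_X, C_1, one_mul, Equiv.symm_symm]
  obtain ⟨l, hl⟩ := (Submodule.mem_span_range_iff_exists_fun ℂ).1 hmem
  refine ⟨l, fun j => ?_⟩
  have hv : w - ∑ i, l i • uTilde a b r s i ∈ ((polyRep φ).tprod (ρ).dual).invariants :=
    Submodule.sub_mem _ hw (Submodule.sum_mem _ fun i _ =>
      Submodule.smul_mem _ _ (uTilde_mem_invariants hζ ha hsab hσ i))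
  have hj₀ : component j₀ (w - ∑ i, l i • uTilde a b r s i) ∈ invIdeal φ := by
    rw [← mkQ_eq_zero, map_sub, map_sub, map_sum, map_sum, ← hl, sub_eq_zero]
    refine Finset.sum_congr rfl fun i _ => ?_
    rw [map_smul, map_smul, component_uTilde]
  obtain ⟨g, hg⟩ := describes_of (K := K) (a := a) (b := b) (Equiv.swap j j₀) (fun _ => 1)
    (by simp) (by simp)
  have h1 := hperm (Equiv.swap j j₀) _ hv j
  rw [Equiv.swap_apply_left] at h1
  rw [← h1]
  have h2 := polyRep_mem_invIdeal hj₀ g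
  rw [hg.polyRep] at h2
  simpa using h2

/-- The projection fixes a harmonic invariant and kills its difference from a combination of the
`ũ_i`. -/
theorem dualOS_eq_span (hζ : IsPrimitiveRoot ζ (a * b)) (hr : 0 < r) (hs : 0 < s)
    (hsab : s < a * b) (hσ : σ ζ = ζ ^ s)
    (hC : IsCompl (harmonics φ) ((invIdeal φ).restrictScalars ℂ)) :
    dualOS φ ρ = Submodule.span ℂ (Set.range fun i =>
      LinearMap.rTensor (Module.Dual ℂ (Fin r → ℂ)) (Submodule.projection _ _ hC)
        (uTilde a b r s i)) := by
  have hab : a * b ≠ 0 := by omega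
  have ha : 0 < a := Nat.pos_of_ne_zero (left_ne_zero_of_mul hab)
  refine le_antisymm ?_ (Submodule.span_le.2 ?_)
  · rintro w ⟨hwC, hw⟩
    obtain ⟨l, hl⟩ := exists_sum_sub_mem_invIdeal hζ hr hs hsab hσ hw
    have h1 : LinearMap.rTensor (Module.Dual ℂ (Fin r → ℂ)) (Submodule.projection _ _ hC) w = w :=
      component_ext fun j => by
        rw [component_rTensor]
        exact Submodule.projection_apply_of_mem_left hC (mem_tensorDual_iff.1 hwC j)
    have h2 : LinearMap.rTensor (Module.Dual ℂ (Fin r → ℂ)) (Submodule.projection _ _ hC)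
        (w - ∑ i, l i • uTilde a b r s i) = 0 :=
      component_ext fun j => by
        rw [component_rTensor, map_zero]
        exact Submodule.projection_apply_of_mem_right hC (hl j)
    rw [map_sub, h1, sub_eq_zero] at h2
    rw [h2]
    simp only [map_sum, map_smul]
    exact Submodule.sum_mem _ fun i _ => Submodule.smul_mem _ _ (Submodule.subset_span ⟨i, rfl⟩)
  · rintro _ ⟨i, rfl⟩
    exact rTensor_projection_mem_dualOS hζ hab hσ hC (uTilde_mem_invariants hζ ha hsab hσ i)

end Twisted

/-- A single component suffices: its projection vanishes exactly when it lies in the ideal. -/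
theorem linearIndependent_projection_uTilde (hζ : IsPrimitiveRoot ζ (a * b)) (hr : 0 < r)
    (hs : 0 < s) (hsab : s < a * b)
    (hC : IsCompl (harmonics φ) ((invIdeal φ).restrictScalars ℂ)) :
    LinearIndependent ℂ fun i =>
      LinearMap.rTensor (Module.Dual ℂ (Fin r → ℂ)) (Submodule.projection _ _ hC)
        (uTilde a b r s i) := by
  have ha : 0 < a := Nat.pos_of_ne_zero fun h => by simp [h] at hsab
  obtain ⟨hc, hc'⟩ := ceil_bounds (s := s) ha
  rw [Fintype.linearIndependent_iff]
  intro l hl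
  have h1 := congrArg (component (⟨0, hr⟩ : Fin r)) hl
  simp only [← map_smul, ← map_sum] at h1
  rw [component_rTensor, map_zero, Submodule.projection_apply_eq_zero_iff] at h1
  simp only [map_sum, map_smul, component_uTilde] at h1
  exact congrFun (eq_zero_of_sum_mem_invIdeal hζ hs hsab hc hc' _ h1)

theorem uTilde_mem_homogeneous (ha : 0 < a) (i : Fin r) :
    uTilde a b r s i ∈ tensorDual (Fin r → ℂ)
      (homogeneousSubmodule (Fin r) ℂ (uDeg a b r s ⌈(s : ℚ) / a⌉₊ i)) := by
  refine mem_tensorDual_iff.2 fun j => ?_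
  rw [component_uTilde]
  exact isHomogeneous_monomial _ (degree_uExp (ceil_bounds ha).1 i j)

theorem degProj_rTensor_projection (hab : a * b ≠ 0)
    (hC : IsCompl (harmonics φ) ((invIdeal φ).restrictScalars ℂ)) (d : ℕ) (w : SV) :
    degProj d (LinearMap.rTensor (Module.Dual ℂ (Fin r → ℂ)) (Submodule.projection _ _ hC) w) =
      LinearMap.rTensor (Module.Dual ℂ (Fin r → ℂ)) (Submodule.projection _ _ hC)
        (degProj d w) := by
  refine component_ext fun j => ?_
  simp only [degProj, component_rTensor]
  rw [projection_homogeneousComponent (isUnitaryMonomial_inclGL hab)]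

theorem map_uDeg_univ (a b s c : ℕ) (hr : 0 < r) :
    (Multiset.range (r - 1)).map (fun i => a * b * (i + 1) - s) + {c * a * r - s} =
      (Finset.univ : Finset (Fin r)).val.map (uDeg a b r s c) := by
  obtain ⟨n, rfl⟩ : ∃ n, r = n + 1 := ⟨r - 1, by omega⟩
  rw [Fin.univ_castSuccEmb, Finset.cons_val, Multiset.map_cons, Finset.map_val, Multiset.map_map,
    ← Multiset.singleton_add, add_comm, Nat.add_sub_cancel]
  congr 1
  · simp [uDeg]
  · rw [← Finset.range_val, ← Nat.Iio_eq_range, ← Fin.map_valEmbedding_univ, Finset.map_val, Multiset.map_map]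
    refine Multiset.map_congr rfl fun i _ => ?_
    simp [uDeg]

theorem coeff_sum_X_pow {ι : Type*} [Fintype ι] (deg : ι → ℕ) (d : ℕ) :
    PowerSeries.coeff d (((Finset.univ : Finset ι).val.map deg).map
      fun e => (PowerSeries.X : PowerSeries ℕ) ^ e).sum = Fintype.card {i // deg i = d} := by
  classical
  rw [Multiset.map_map]
  change PowerSeries.coeff d (∑ i, PowerSeries.X ^ deg i) = _
  rw [map_sum, Fintype.card_subtype, Finset.card_filter]
  refine Finset.sum_congr rfl fun i _ => ?_
  rw [PowerSeries.coeff_X_pow]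
  simp only [eq_comm]

end Main

end

end ReflExp

/-! ### The isomorphism and the exponents -/

open scoped TensorProduct in
theorem mainTheorem7 (a b r s : ℕ) (ha : 1 ≤ a) (hb : 1 ≤ b) (hr : 1 ≤ r)
    (hs : 1 ≤ s) (hsab : s < a * b) (hcop : Nat.Coprime s (a * b))
    {K : Type*} [Field K] [Algebra ℚ K] [IsCyclotomicExtension {a * b} ℚ K] [Algebra K ℂ]
    (ζ : K) (hζ : IsPrimitiveRoot ζ (a * b)) (σ : K ≃ₐ[ℚ] K) (hσ : σ ζ = ζ ^ s) :
    (∃ hC : IsCompl (ReflExp.harmonics (ReflExp.inclGL (ReflExp.imprimitiveGroup K a b r)))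
        ((ReflExp.invIdeal
          (ReflExp.inclGL (ReflExp.imprimitiveGroup K a b r))).restrictScalars ℂ),
      ReflExp.RestrictsToGradedIso
        (LinearMap.rTensor (Module.Dual ℂ (Fin r → ℂ)) (Submodule.projection _ _ hC))
        (Submodule.span ℂ (Set.range (ReflExp.uTilde a b r s)))
        (ReflExp.dualOS (ReflExp.inclGL (ReflExp.imprimitiveGroup K a b r))
          (ReflExp.galoisTwist (ReflExp.imprimitiveGroup K a b r) (σ : K →+* K)))) ∧
    ReflExp.IsExponents (ReflExp.inclGL (ReflExp.imprimitiveGroup K a b r))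
      (ReflExp.galoisTwist (ReflExp.imprimitiveGroup K a b r) (σ : K →+* K))
      ((Multiset.range (r - 1)).map (fun i => a * b * (i + 1) - s) +
        {⌈(s : ℚ) / a⌉₊ * a * r - s}) := by
  have hab : a * b ≠ 0 := by omega
  have hC := ReflExp.isCompl_harmonics_invIdeal
    (ReflExp.isUnitaryMonomial_inclGL (K := K) (r := r) hab)
  have hli := ReflExp.linearIndependent_projection_uTilde hζ hr hs hsab hC
  have hdeg := ReflExp.uTilde_mem_homogeneous (b := b) (r := r) (s := s) ha
  have hspan := ReflExp.dualOS_eq_span hζ hr hs hsab hσ hC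
  have hcomm := ReflExp.degProj_rTensor_projection hab hC
  refine ⟨⟨hC, ?_⟩, ?_⟩
  · rw [hspan]
    exact ReflExp.restrictsToGradedIso_span hdeg hcomm hli
  · rw [ReflExp.IsExponents, ReflExp.map_uDeg_univ _ _ _ _ hr]
    ext d
    rw [ReflExp.coeff_sum_X_pow, ReflExp.fakeDegree, PowerSeries.coeff_mk, hspan,
      ReflExp.finrank_degPart_span (fun i => ?_) hli]
    rw [ReflExp.mem_tensorDual_homogeneous_iff, hcomm,
      ReflExp.mem_tensorDual_homogeneous_iff.1 (hdeg i)]
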